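/- **Setting.** A (deterministic) hypergraph grammar $\mathcal G$ over finite ranked alphabets consists of non-terminals $A$ of arity $\varrho(A)$, an axiom $Z$ of arity $0$, colours (terminals of arity 1), arc labels (terminals of arity 2), and for each non-terminal $A$ a finite hypergraph $H_A$ with an injection $\iota_A:\{1,\dots,\varrho(A)\}\hookrightarrow V_{H_A}$. Vertices in the image of $\iota_A$ are the inputs of $H_A$; vertices lying on a non-terminal hyperarc of $H_A$ are its outputs. Assume (as for complete outside grammars generating graphs of finite degree) that in every $H_A$ outputs are distinct from inputs and each output lies on a single non-terminal hyperarc, at a single position. Let $R^n[A]$ be the hypergraph obtained from a hyperarc labelled $A$ by $n$ complete parallel rewritings (every non-terminal hyperarc labelled $B$ is replaced by a copy of $H_B$, its inputs being identified with the vertices of the hyperarc and the other vertices being fresh), and $R^\omega[Z]$ the generated graph; the level $\mathrm{Lev}(v)$ is the rewriting step at which $v$ is created. Let $\mu$ assign to each arc label a number in $[0,1]$, such that at each vertex of $R^\omega[Z]$ the $\mu$-values of the outgoing arcs sum to $1$. This makes $R^\omega[Z]$ a Markov chain $\mathcal M$; and each $R^n[A]$ a finite portion of a Markov chain, in which paths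 that leave the portion are lost. Let $V_1,V_2$ be the sets of vertices bearing two given colours. Below, $A$ ranges over the non-terminals that occur in the rewritings of $Z$. $B_i$, $D_h$ denote the $i$-th ($h$-th) position of a non-terminal hyperarc of $H_A$, labelled $B$ (resp. $D$; $D=B$ allowed); $C_k$ the $k$-th position of a non-terminal hyperarc, labelled $C$, of $H_B$; $A_j$ the $j$-th position of $A$, i.e. the vertex $\iota_A(j)$. Hyperarcs of $H_A$ with the same label are kept apart. A vertex $v'$ of $\mathcal M$ has $\mathsf{Can}(v')=(B,i)_A$ if it was created in a copy of $H_A$, as the copy of the $i$-th vertex of the hyperarc $B$. For such a $v'$ let * $\mathrm{Dec}(B_i,A_j)$ be the probability in $\mathcal M$, from $v'$, to reach the vertex $\iota_A(j)$ of that copy (at level $\mathrm{Lev}(v')-1$), all vertices before it being in $(V_1\setminus V_2)\cap(\mathrm{Lev}\ge \mathrm{Lev}(v'))$; * $\mathrm{Win}(B_i)_A$ be the probability in $\mathcal M$, from $v'$, to fulfil $V_1\,\mathsf U\,V_2$ along vertices of level $\ge\mathrm{Lev}(v')$ only (the vertex of $V_2$ included). Call a vertex of $R^2[A]$ special if it is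 some $\iota_A(j)$ or lies on a non-terminal hyperarc of $H_A$, or of a copy of some $H_D$ replacing a hyperarc $D$ of $H_A$. In $R^2[A]$, from the vertex $(B,i)_A$, let * $p(B_i)_A$ be the probability to fulfil $V_1\,\mathsf U\,V_2$ without visiting, after the initial vertex and until $V_2$ is reached (the reached vertex included), any special vertex; * $p(B_i,D_h)_A$, $\overleftarrow p(B_i,A_j)$, $\overrightarrow p(B_i,C_k)_A$ be the probability that the first special vertex visited at a positive time is $(D,h)_A$, resp. $\iota_A(j)$, resp. $(C,k)_B$ (in the copy of $H_B$ replacing the hyperarc of $B_i$), all vertices before it, the initial one included, being in $V_1\setminus V_2$. **Theorem.** (a) $\mathrm{Dec}(B_i,A_j)$ and $\mathrm{Win}(B_i)_A$ do not depend on the choice of $v'$ with $\mathsf{Can}(v')=(B,i)_A$. (b) They satisfy the equations $$\mathrm{Dec}(B_i,A_j)=\overleftarrow p(B_i,A_j)+\sum_{D_h}p(B_i,D_h)_A\,\mathrm{Dec}(D_h,A_j)+\sum_{C_k}\overrightarrow p(B_i,C_k)_A\sum_{B_\ell}\mathrm{Dec}(C_k,B_\ell)\,\mathrm{Dec}(B_\ell,A_j),$$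 $$\mathrm{Win}(B_i)_A=p(B_i)_A+\sum_{D_h}p(B_i,D_h)_A\,\mathrm{Win}(D_h)_A+\sum_{C_k}\overrightarrow p(B_i,C_k)_A\Bigl(\mathrm{Win}(C_k)_B+\sum_{B_j}\mathrm{Dec}(C_k,B_j)\,\mathrm{Win}(B_j)_A\Bigr),$$ where $B_\ell$ and $B_j$ run over the positions of the hyperarc of $B_i$. (c) They form the least nonnegative real solution of this system together with the constraints: if $B_i\notin V_1\setminus V_2$ then $\mathrm{Dec}(B_i,A_j)=0$ for every $A_j$; if $B_i\in V_2$ then $\mathrm{Win}(B_i)_A=1$; if $B_i\notin V_1\cup V_2$ then $\mathrm{Win}(B_i)_A=0$. (d) For every vertex $v_0$ of $H_Z$, $$\mathrm{Prob}(v_0\models V_1\,\mathsf U\,V_2)=p(v_0)_Z+\sum_{A_i}\overrightarrow p(v_0,A_i)_Z\,\mathrm{Win}(A_i)_Z ,$$ where $A_i$ runs over the positions of the non-terminal hyperarcs of $H_Z$, $p(v_0)_Z$ is the probability in $R^1[Z]$ (the terminal part of $H_Z$), from $v_0$, to fulfil $V_1\,\mathsf U\,V_2$ without visiting a vertex on a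 non-terminal hyperarc (including $v_0$), and $\overrightarrow p(v_0,A_i)_Z$ is the probability in $R^1[Z]$, from $v_0$, to reach the vertex $(A,i)_Z$ (at a time $\ge 0$), all vertices before it being in $V_1\setminus V_2$ and on no non-terminal hyperarc. -/

import Mathlib

open scoped ENNReal

/-! ### Hypergraphs and hypergraph grammars -/

/-- A hypergraph with vertices in `V` over ranked non-terminals `N` (of arity `ar`), colours `T₁`
(terminals of arity one) and arc labels `T₂` (terminals of arity two), given by its set of
non-terminal hyperarcs `B v₁ ⋯ vₚ`, its set of colours `c v` and its set of arcs `a s t`. -/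
structure ColHypergraph {N : Type*} (ar : N → ℕ) (T₁ T₂ V : Type*) where
  nt : Set (Σ B : N, (Fin (ar B) → V))
  col : Set (T₁ × V)
  arc : Set (T₂ × V × V)

/-- The vertices of the graph `[H]`, i.e. those lying on a terminal arc or bearing a colour. -/
def ColHypergraph.terminalVerts {N : Type*} {ar : N → ℕ} {T₁ T₂ V : Type*}
    (H : ColHypergraph ar T₁ T₂ V) : Set V :=
  {v | (∃ c, (c, v) ∈ H.col) ∨ (∃ a w, (a, v, w) ∈ H.arc) ∨ ∃ a w, (a, w, v) ∈ H.arc}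

/-- The set of vertices of colour `c`. -/
def ColHypergraph.colour {N : Type*} {ar : N → ℕ} {T₁ T₂ V : Type*}
    (H : ColHypergraph ar T₁ T₂ V) (c : T₁) : Set V :=
  {v | (c, v) ∈ H.col}

/-- A (deterministic) hypergraph grammar. The rule of the non-terminal `A` is the hypergraph
`rhs A`, on the finite vertex set `V A`, with the injection `inp A` of the positions of `A`.
(The right-hand sides are finite hypergraphs as soon as the alphabets are finite.) -/
structure HRGrammar (N T₁ T₂ : Type*) where
  ar : N → ℕ
  start : N
  start_arity : ar start = 0
  V : N → Type*
  finite_V : ∀ A, Finite (V A)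
  inp : ∀ A, Fin (ar A) ↪ V A
  rhs : ∀ A, ColHypergraph ar T₁ T₂ (V A)

namespace HRGrammar

variable {N T₁ T₂ : Type*} (G : HRGrammar N T₁ T₂)

/-- The non-terminal hyperarcs of the right-hand side of `A`. -/
def Arc (A : N) : Type _ := {e : Σ B : N, (Fin (G.ar B) → G.V A) // e ∈ (G.rhs A).nt}

noncomputable instance [Finite N] (A : N) : Fintype (G.Arc A) :=
  haveI := G.finite_V
  haveI : Finite (G.Arc A) :=
    inferInstanceAs (Finite {e : Σ B : N, (Fin (G.ar B) → G.V A) // e ∈ (G.rhs A).nt})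
  Fintype.ofFinite _

variable {G}

/-- The label of a non-terminal hyperarc. -/
def Arc.lab {A : N} (e : G.Arc A) : N := e.1.1

/-- The vertices on a non-terminal hyperarc. -/
def Arc.att {A : N} (e : G.Arc A) : Fin (G.ar e.lab) → G.V A := e.1.2

variable (G)

/-- The conditions granted by complete outside grammars that generate graphs of finite degree:
outputs (vertices on non-terminal hyperarcs) are distinct from inputs, each output lies on a single
non-terminal hyperarc, and at a single position of it. -/
structure IsOutside : Prop where
  output_ne_input : ∀ A (e : G.Arc A) i j, e.att i ≠ G.inp A j
  att_injective : ∀ A (e : G.Arc A), Function.Injective e.att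
  unique_arc : ∀ A (e e' : G.Arc A) i i', e.att i = e'.att i' → e = e'

/-! ### The generated graph -/

/-- `G.Occ A B`: the occurrences of hyperarcs labelled `B` met when iterating the complete parallel
rewriting from a single hyperarc labelled `A`. -/
inductive Occ (A : N) : N → Type _
  | root : Occ A A
  | child {B : N} (X : Occ A B) (e : G.Arc B) : Occ A e.lab

variable {G}

/-- The number of complete parallel rewritings after which an occurrence appears. -/
def Occ.depth {A : N} : {B : N} → G.Occ A B → ℕ
  | _, .root => 0
  | _, .child X _ => X.depth + 1

variable (G)

/-- Vertices of the graphs rewritten from a single hyperarc labelled `A`: the vertices of that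
hyperarc, and, for every occurrence `X` of a hyperarc labelled `B`, a fresh copy of the vertices of
the right-hand side of `B` that are not inputs. -/
def Vertex (A : N) : Type _ :=
  Fin (G.ar A) ⊕ (Σ B : N, G.Occ A B × {v : G.V B // v ∉ Set.range (G.inp B)})

variable {G}

/-- The level at which a vertex is generated. -/
def Vertex.lev {A : N} : G.Vertex A → ℕ
  | .inl _ => 0
  | .inr ⟨_, X, _⟩ => X.depth + 1

open Classical in
/-- The morphism mapping the right-hand side of `B` into the graph when the occurrence `X` is
rewritten: an input is sent to the vertex at the corresponding position of the rewritten hyperarc,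
any other vertex to its fresh copy. -/
noncomputable def Occ.place {A : N} : {B : N} → G.Occ A B → G.V B → G.Vertex A
  | _, .root, v =>
      if h : v ∈ Set.range (G.inp A) then .inl h.choose else .inr ⟨A, .root, v, h⟩
  | _, .child X e, v =>
      if h : v ∈ Set.range (G.inp e.lab) then X.place (e.att h.choose)
      else .inr ⟨e.lab, .child X e, v, h⟩

variable (G)

/-- The hypergraph obtained from a single hyperarc labelled `A` after `n` complete parallel
rewritings; for `n = ⊤`, the infinite graph generated from this hyperarc. -/
def rewr (n : ℕ∞) (A : N) : ColHypergraph G.ar T₁ T₂ (G.Vertex A) where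
  nt := {Y | ∃ (B : N) (X : G.Occ A B), (X.depth : ℕ∞) = n ∧ Y = ⟨B, fun i => X.place (G.inp B i)⟩}
  col := {p | ∃ (B : N) (X : G.Occ A B), (X.depth : ℕ∞) < n ∧
    ∃ u, (p.1, u) ∈ (G.rhs B).col ∧ p.2 = X.place u}
  arc := {p | ∃ (B : N) (X : G.Occ A B), (X.depth : ℕ∞) < n ∧
    ∃ u w, (p.1, u, w) ∈ (G.rhs B).arc ∧ p.2.1 = X.place u ∧ p.2.2 = X.place w}

/-- The vertices lying on a non-terminal hyperarc at some step of the `n` first rewritings. -/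
def ports (n : ℕ) (A : N) : Set (G.Vertex A) :=
  {x | ∃ m ≤ n, ∃ Y ∈ (G.rewr (m : ℕ∞) A).nt, ∃ i, Y.2 i = x}

/-- The non-terminals that occur in the rewritings of the start symbol. -/
def Reach : Type _ := {A : N // Nonempty (G.Occ G.start A)}

variable {G}

/-- A non-terminal in the right-hand side of a reachable one is reachable. -/
def Reach.succ (A : G.Reach) (e : G.Arc A.1) : G.Reach := ⟨e.lab, A.2.map fun X => X.child e⟩

end HRGrammar

/-! ### Markov chains -/

/-- The probability of moving from `s` to `t`: the sum of the values of the arcs from `s` to `t`. -/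
noncomputable def ColHypergraph.weight {N : Type*} {ar : N → ℕ} {T₁ T₂ V : Type*} [Fintype T₂]
    (H : ColHypergraph ar T₁ T₂ V) (μ : T₂ → Set.Icc (0 : ℝ) 1) (s t : V) : ℝ≥0∞ :=
  open Classical in ∑ a, if (a, s, t) ∈ H.arc then ENNReal.ofReal (μ a) else 0

/-- `(G, μ)` is a probabilistic grammar: at each vertex of the generated graph, the values of the
outgoing arcs sum to one. -/
def HRGrammar.IsProbabilistic {N T₁ T₂ : Type*} [Fintype T₂] (G : HRGrammar N T₁ T₂)
    (μ : T₂ → Set.Icc (0 : ℝ) 1) : Prop :=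
  ∀ v ∈ (G.rewr ⊤ G.start).terminalVerts,
    ∑ a, ENNReal.ofReal (μ a) *
      (({w | (a, v, w) ∈ (G.rewr ⊤ G.start).arc} : Set _).encard : ℝ≥0∞) = 1

/-- The states of the Markov chain of a weighted graph on `S`: the elements of `S`, and a cemetery
`none`, which receives the probability missing at the vertices whose outgoing weights sum to less
than one (as happens in a finite portion of an infinite Markov chain). -/
def ChainState (S : Type*) : Type _ := Option S

instance (S : Type*) : MeasurableSpace (ChainState S) := ⊤

/-- Total mass of a row completed by the cemetery. -/
theorem completed_row_sum {S : Type*} (f : S → ℝ≥0∞) (h : ∑' t, f t ≤ 1) :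
    ∑' o : Option S, o.elim (1 - ∑' t, f t) f = 1 := by
  rw [← (Equiv.optionEquivSumPUnit.{0} S).symm.tsum_eq, ENNReal.summable.tsum_sum ENNReal.summable]
  simpa using add_tsub_cancel_of_le h

open Classical in
/-- One step of the chain with weights `w`. (Weights summing to more than one never occur in what
follows.) -/
noncomputable def stepLaw {S : Type*} (w : S → S → ℝ≥0∞) : ChainState S → PMF (ChainState S)
  | none => PMF.pure none
  | some s =>
      if h : ∑' t, w s t ≤ 1 then
        ⟨fun o => Option.elim o (1 - ∑' t, w s t) (w s),
          ENNReal.summable.hasSum_iff.2 (completed_row_sum (w s) h)⟩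
      else PMF.pure none

/-- The transition kernel of the chain. -/
noncomputable def stepKernel {S : Type*} (w : S → S → ℝ≥0∞) :
    ProbabilityTheory.Kernel (ChainState S) (ChainState S) where
  toFun s := (stepLaw w s).toMeasure
  measurable' := measurable_from_top

instance {S : Type*} (w : S → S → ℝ≥0∞) : ProbabilityTheory.IsMarkovKernel (stepKernel w) :=
  ⟨fun s => inferInstanceAs (MeasureTheory.IsProbabilityMeasure (stepLaw w s).toMeasure)⟩

/-- The law, on infinite paths, of the chain with weights `w` started from `s`. -/
noncomputable def pathLaw {S : Type*} (w : S → S → ℝ≥0∞) (s : S) :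
    MeasureTheory.Measure (ℕ → ChainState S) :=
  ProbabilityTheory.Kernel.traj (X := fun _ => ChainState S)
    (fun n => (stepKernel w).comap
      (fun x : (Π _ : Finset.Iic n, ChainState S) => x ⟨n, Finset.mem_Iic.2 le_rfl⟩)
      (measurable_pi_apply _))
    0 (fun _ => (some s : Option S))

/-- At time `n` the path `ω` is in the set `U`. -/
def AtTime {S : Type*} (ω : ℕ → ChainState S) (n : ℕ) (U : Set S) : Prop :=
  ∃ x ∈ U, ω n = (some x : Option S)

/-- The probability that the path from `s` satisfies `K U T`: it reaches `T`, and all its vertices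
before that are in `K`. -/
noncomputable def probUntil {S : Type*} (w : S → S → ℝ≥0∞) (s : S) (K T : Set S) : ℝ :=
  (pathLaw w s).real {ω | ∃ n, AtTime ω n T ∧ ∀ m < n, AtTime ω m K}

/-- The probability that the path from `s` satisfies `K U T` and that, after its initial vertex, no
vertex of `X` is visited until `T` is reached, the reached vertex of `T` included. -/
noncomputable def probUntilAvoiding {S : Type*} (w : S → S → ℝ≥0∞) (s : S) (K T X : Set S) : ℝ :=
  (pathLaw w s).real {ω | ∃ n, AtTime ω n T ∧ (∀ m < n, AtTime ω m K) ∧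
    ∀ m, 1 ≤ m → m ≤ n → ¬ AtTime ω m X}

/-- The probability that the path from `s` reaches the vertex `t` at a positive time, with all its
vertices before that in `K`, and no vertex of `X` strictly between the initial vertex and `t`. -/
noncomputable def probFirstHit {S : Type*} (w : S → S → ℝ≥0∞) (s : S) (K X : Set S) (t : S) : ℝ :=
  (pathLaw w s).real {ω | ∃ n, 1 ≤ n ∧ AtTime ω n {t} ∧ (∀ m < n, AtTime ω m K) ∧
    ∀ m, 1 ≤ m → m < n → ¬ AtTime ω m X}

namespace HRGrammar

variable {N T₁ T₂ : Type*} [Fintype T₂] (G : HRGrammar N T₁ T₂) (μ : T₂ → Set.Icc (0 : ℝ) 1)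
  (c₁ c₂ : T₁)

/-! ### Probabilities in the infinite Markov chain

`c₁` and `c₂` are the colours marking the sets `V₁` and `V₂`. In an occurrence `X` of the
non-terminal `A`, the vertex with canonical image `(B, i)_A` is `X.place (e.att i)`, where `e` is
the hyperarc of the right-hand side of `A` labelled `B`. -/

/-- `Prob (v ⊨ V₁ U V₂)`. -/
noncomputable def probU (v : G.Vertex G.start) : ℝ :=
  probUntil ((G.rewr ⊤ G.start).weight μ) v
    ((G.rewr ⊤ G.start).colour c₁) ((G.rewr ⊤ G.start).colour c₂)

variable {G}

/-- The probability from the vertex `v'` at position `i` of the hyperarc `e`, in the occurrence `X`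
of `A`, to reach the vertex at position `j` of `A` along a path in
`(V₁ \ V₂) ∩ (Lev ≥ Lev v')`. -/
noncomputable def decAt {A : N} (X : G.Occ G.start A) (e : G.Arc A) (i : Fin (G.ar e.lab))
    (j : Fin (G.ar A)) : ℝ :=
  probUntil ((G.rewr ⊤ G.start).weight μ) (X.place (e.att i))
    (((G.rewr ⊤ G.start).colour c₁ \ (G.rewr ⊤ G.start).colour c₂) ∩
      {x | (X.place (e.att i)).lev ≤ x.lev})
    {X.place (G.inp A j)}

/-- The probability from the vertex `v'` at position `i` of the hyperarc `e`, in the occurrence `X`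
of `A`, to fulfil `V₁ U V₂` within `Lev ≥ Lev v'`. -/
noncomputable def winAt {A : N} (X : G.Occ G.start A) (e : G.Arc A) (i : Fin (G.ar e.lab)) : ℝ :=
  probUntil ((G.rewr ⊤ G.start).weight μ) (X.place (e.att i))
    ((G.rewr ⊤ G.start).colour c₁ ∩ {x | (X.place (e.att i)).lev ≤ x.lev})
    ((G.rewr ⊤ G.start).colour c₂ ∩ {x | (X.place (e.att i)).lev ≤ x.lev})

/-! ### Local probabilities, computed in the finite graph `R²[A]` -/

variable (G)

/-- The colour sets in `R²[A]`. -/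
def locCol (A : N) (c : T₁) : Set (G.Vertex A) := (G.rewr 2 A).colour c

variable {G}

/-- The vertex `(B, i)_A` of `R²[A]`. -/
noncomputable def vB {A : N} (e : G.Arc A) (i : Fin (G.ar e.lab)) : G.Vertex A :=
  (Occ.root : G.Occ A A).place (e.att i)

/-- The vertex `(C, k)_B` of `R²[A]`, for the hyperarc `e` labelled `B` of the right-hand side of
`A`. -/
noncomputable def vC {A : N} (e : G.Arc A) (c : G.Arc e.lab) (k : Fin (G.ar c.lab)) : G.Vertex A :=
  ((Occ.root : G.Occ A A).child e).place (c.att k)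

variable (G) in
/-- The input `A_j` of `R²[A]`. -/
noncomputable def vA (A : N) (j : Fin (G.ar A)) : G.Vertex A :=
  (Occ.root : G.Occ A A).place (G.inp A j)

/-- `p(B_i)_A`: fulfil `V₁ U V₂` without visiting any vertex on a non-terminal hyperarc. -/
noncomputable def pWin {A : N} (e : G.Arc A) (i : Fin (G.ar e.lab)) : ℝ :=
  probUntilAvoiding ((G.rewr 2 A).weight μ) (vB e i) (G.locCol A c₁) (G.locCol A c₂) (G.ports 2 A)

/-- The probability in `R²[A]`, from `(B, i)_A`, that the first vertex visited on a non-terminal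
hyperarc is `x` and that all vertices before it are in `V₁ \ V₂`. -/
noncomputable def pHit {A : N} (e : G.Arc A) (i : Fin (G.ar e.lab)) (x : G.Vertex A) : ℝ :=
  probFirstHit ((G.rewr 2 A).weight μ) (vB e i) (G.locCol A c₁ \ G.locCol A c₂) (G.ports 2 A) x

/-- `p(B_i, D_h)_A`. -/
noncomputable def pLevel {A : N} (e : G.Arc A) (i : Fin (G.ar e.lab)) (d : G.Arc A)
    (h : Fin (G.ar d.lab)) : ℝ := pHit μ c₁ c₂ e i (vB d h)

/-- `p(B_i, A_j)` with an arrow to the left. -/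
noncomputable def pLeft {A : N} (e : G.Arc A) (i : Fin (G.ar e.lab)) (j : Fin (G.ar A)) : ℝ :=
  pHit μ c₁ c₂ e i (G.vA A j)

/-- `p(B_i, C_k)_A` with an arrow to the right. -/
noncomputable def pRight {A : N} (e : G.Arc A) (i : Fin (G.ar e.lab)) (c : G.Arc e.lab)
    (k : Fin (G.ar c.lab)) : ℝ := pHit μ c₁ c₂ e i (vC e c k)

variable (G)

/-- `p(v₀)_Z`: in the right-hand side of `Z`, the probability to fulfil `V₁ U V₂` without visiting
any vertex on a non-terminal hyperarc. -/
noncomputable def pStart (v₀ : G.V G.start) : ℝ :=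
  probUntil ((G.rewr 1 G.start).weight μ) ((Occ.root : G.Occ G.start G.start).place v₀)
    ((G.rewr 1 G.start).colour c₁ \ G.ports 1 G.start)
    ((G.rewr 1 G.start).colour c₂ \ G.ports 1 G.start)

/-- `p(v₀, A_i)_Z` with an arrow to the right: in the right-hand side of `Z`, the probability to
reach the vertex at position `i` of the hyperarc `e`, with all vertices before it in `V₁ \ V₂` and
on no non-terminal hyperarc. -/
noncomputable def pStartRight (v₀ : G.V G.start) (e : G.Arc G.start) (i : Fin (G.ar e.lab)) : ℝ :=
  probUntil ((G.rewr 1 G.start).weight μ) ((Occ.root : G.Occ G.start G.start).place v₀)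
    (((G.rewr 1 G.start).colour c₁ \ (G.rewr 1 G.start).colour c₂) \ G.ports 1 G.start)
    {vB e i}

/-! ### The system of equations -/

/-- Valuations of the variables `Dec(B_i, A_j)`. -/
abbrev DecVal : Type _ :=
  ∀ (A : G.Reach) (e : G.Arc A.1), Fin (G.ar e.lab) → Fin (G.ar A.1) → ℝ

/-- Valuations of the variables `Win(B_i)_A`. -/
abbrev WinVal : Type _ := ∀ (A : G.Reach) (e : G.Arc A.1), Fin (G.ar e.lab) → ℝ

variable {G} [Finite N]

/-- The polynomial equations satisfied by the `Dec(B_i, A_j)`. -/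
def DecEquations (x : G.DecVal) : Prop :=
  ∀ (A : G.Reach) (e : G.Arc A.1) (i : Fin (G.ar e.lab)) (j : Fin (G.ar A.1)),
    x A e i j = pLeft μ c₁ c₂ e i j
      + ∑ d : G.Arc A.1, ∑ h : Fin (G.ar d.lab), pLevel μ c₁ c₂ e i d h * x A d h j
      + ∑ c : G.Arc e.lab, ∑ k : Fin (G.ar c.lab), pRight μ c₁ c₂ e i c k *
          ∑ l : Fin (G.ar e.lab), x (A.succ e) c k l * x A e l j

/-- The polynomial equations satisfied by the `Win(B_i)_A`. -/
def WinEquations (x : G.DecVal) (y : G.WinVal) : Prop :=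
  ∀ (A : G.Reach) (e : G.Arc A.1) (i : Fin (G.ar e.lab)),
    y A e i = pWin μ c₁ c₂ e i
      + ∑ d : G.Arc A.1, ∑ h : Fin (G.ar d.lab), pLevel μ c₁ c₂ e i d h * y A d h
      + ∑ c : G.Arc e.lab, ∑ k : Fin (G.ar c.lab), pRight μ c₁ c₂ e i c k *
          (y (A.succ e) c k + ∑ j : Fin (G.ar e.lab), x (A.succ e) c k j * y A e j)

/-- The boundary constraints. -/
def BoundaryConstraints (x : G.DecVal) (y : G.WinVal) : Prop :=
  ∀ (A : G.Reach) (e : G.Arc A.1) (i : Fin (G.ar e.lab)),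
    (vB e i ∉ G.locCol A.1 c₁ \ G.locCol A.1 c₂ → ∀ j, x A e i j = 0) ∧
    (vB e i ∈ G.locCol A.1 c₂ → y A e i = 1) ∧
    (vB e i ∉ G.locCol A.1 c₁ ∪ G.locCol A.1 c₂ → y A e i = 0)

end HRGrammar

/-! All quantities are treated as `[0,∞]`-valued rewards `reward w n K g`: the sum over times `k <
n` of the `k`-th iterate of the chain killed outside `K`, applied to `g`. An until-probability is
the reward of the indicator of the target, with `K` deprived of the target (`ofReal_probUntil`).
Rewards are linear in `g`, satisfy a one-step equation (`reward_succ`) and the strong Markov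
property (`reward_stopped`), and are preserved by maps that preserve transitions
(`reward_transfer`).

Independence of the occurrence is self-similarity. The graph generated by a hyperarc labelled `B`
embeds at each of its occurrences (`Occ.emb`), and at vertices that are not inputs the outgoing arcs
and the colours are exactly those of the image. The level restriction in `Dec` and `Win` pulls back
to "not an input", so both are rewards `dec`, `win` in the graph generated from the non-terminal
alone.

For the equations, stop the walk from `(B,i)_A` at its first positive time on a port of `R²[A]`.
Until then it stays on the root copy and on the copy replacing the hyperarc `B`, where `R²[A]`
already has all relevant arcs and colours; the ports it can meet are the `A_j`, `D_h`, `C_k`, and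
the weights are the local probabilities (`killedStep_reward_stopAt`). From `C_k` the walk is stopped
once more, on the hyperarc `B`, the only way out of the graph it generates (`reward_stopAt_arc`);
this yields the products.

For minimality, the same expansion is run with a finite horizon. Strong Markov becomes an inequality
(`reward_le_stopped`), and since the first step uses one unit of time, the values for horizon `n +
1` are at most the right-hand sides evaluated at horizon `n`. By monotonicity and induction every
horizon lies below every nonnegative solution, and the supremum over horizons is `dec`, `win`. The
formula from the axiom is the same expansion at the ports of `R¹[Z]`, stopped at a time `≥ 0`. -/

/-! ### Killed chains -/

/-- One step of the chain killed outside `K`, acting on functions. -/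
noncomputable def killedStep {S : Type*} (w : S → S → ℝ≥0∞) (K : Set S) (g : S → ℝ≥0∞) :
    S → ℝ≥0∞ :=
  K.indicator fun s => ∑' t, w s t * g t

/-- The expected total reward `g` collected before time `n` by the chain killed outside `K`. -/
noncomputable def reward {S : Type*} (w : S → S → ℝ≥0∞) (n : ℕ∞) (K : Set S) (g : S → ℝ≥0∞)
    (s : S) : ℝ≥0∞ :=
  ∑' k : ℕ, if (k : ℕ∞) < n then (killedStep w K)^[k] g s else 0

/-! ### Path probabilities as rewards -/

/-- A vertex, seen as a state of the chain. -/
def alive {S : Type*} (s : S) : ChainState S := (some s : Option S)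

/-- Extension by zero to the cemetery. -/
def extendZero {S : Type*} (g : S → ℝ≥0∞) (o : ChainState S) : ℝ≥0∞ :=
  Option.elim o 0 g

open MeasureTheory ProbabilityTheory

theorem lintegral_pmf_toMeasure {α : Type*} [MeasurableSpace α] (p : PMF α) {f : α → ℝ≥0∞}
    (hf : Measurable f) : ∫⁻ a, f a ∂p.toMeasure = ∑' a, p a * f a := by
  have h : p.toMeasure = Measure.sum fun a => p a • Measure.dirac a := by
    ext s hs
    rw [PMF.toMeasure_apply _ hs, Measure.sum_apply _ hs]
    refine tsum_congr fun a => ?_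
    by_cases ha : a ∈ s <;> simp [hs, ha]
  rw [h, lintegral_sum_measure]
  refine tsum_congr fun a => ?_
  rw [lintegral_smul_measure, lintegral_dirac' _ hf, smul_eq_mul]

/-- The missing mass goes to the cemetery, where `extendZero g` vanishes, so only the weights
remain. -/
theorem lintegral_stepKernel_some {S : Type*} {w : S → S → ℝ≥0∞} {s : S}
    (hs : ∑' t, w s t ≤ 1) (g : S → ℝ≥0∞) :
    ∫⁻ o, extendZero g o ∂stepKernel w (alive s) = ∑' t, w s t * g t := by
  change ∫⁻ o, extendZero g o ∂(stepLaw w (alive s)).toMeasure = _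
  rw [lintegral_pmf_toMeasure _ measurable_from_top]
  have h : ∀ o : Option S, stepLaw w (alive s) o =
      o.elim (1 - ∑' t, w s t) (w s) := fun o => by
    change (if h : ∑' t, w s t ≤ 1 then _ else _ : PMF (ChainState S)) o = _
    exact congrFun (congrArg DFunLike.coe (dif_pos hs)) o
  change ∑' o : Option S, stepLaw w (alive s) o * extendZero g o = _
  simp only [h]
  rw [← (Equiv.optionEquivSumPUnit.{0} S).symm.tsum_eq, ENNReal.summable.tsum_sum ENNReal.summable]
  simp [extendZero]

/-- The paths that are in `K m` at every time `m < n`. -/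
def pathsIn {S : Type*} (K : ℕ → Set S) (n : ℕ) : Set (ℕ → ChainState S) :=
  {ω | ∀ m < n, AtTime ω m (K m)}

theorem measurableSet_atTime {S : Type*} (n : ℕ) (U : Set S) :
    MeasurableSet {ω : ℕ → ChainState S | AtTime ω n U} :=
  (measurable_pi_apply (X := fun _ : ℕ => ChainState S) n)
    (t := {o | ∃ x ∈ U, o = (some x : Option S)}) trivial

theorem measurableSet_pathsIn {S : Type*} (K : ℕ → Set S) (n : ℕ) :
    MeasurableSet (pathsIn K n) := by
  have : pathsIn K n = ⋂ m, ⋂ _ : m < n, {ω | AtTime ω m (K m)} := by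
    ext; simp [pathsIn]
  rw [this]
  exact .iInter fun m => .iInter fun _ => measurableSet_atTime m (K m)

theorem extendZero_indicator {S : Type*} (ω : ℕ → ChainState S) (n : ℕ) (T : Set S) :
    extendZero (T.indicator 1) (ω n) = {ω : ℕ → ChainState S | AtTime ω n T}.indicator 1 ω := by
  by_cases h : AtTime ω n T
  · obtain ⟨x, hx, hn⟩ := id h
    rw [hn, Set.indicator_of_mem (show ω ∈ {ω : ℕ → ChainState S | AtTime ω n T} from h)]
    simp [extendZero, hx]
  · rw [Set.indicator_of_notMem (show ω ∉ {ω : ℕ → ChainState S | AtTime ω n T} from h)]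
    rcases hn : ω n with _ | x
    · rfl
    · have : x ∉ T := fun hx => h ⟨x, hx, hn⟩
      simp [extendZero, this]

/-! ### The Markov property of the path law. -/

section
variable {S : Type*} {w : S → S → ℝ≥0∞}

/-- The Markov property at time `n`: integrating out the last coordinate turns `g` into one killed
step. The constraint at time `n` is absorbed by the indicator in `killedStep`, so one fewer remains.
Iterating converts path integrals into powers of `killedStep`. -/
theorem lintegral_pathsIn_succ (hw : ∀ s, ∑' t, w s t ≤ 1) (s : S) (K : ℕ → Set S) (n : ℕ)
    (g : S → ℝ≥0∞) :
    ∫⁻ ω in pathsIn K (n + 1), extendZero g (ω (n + 1)) ∂pathLaw w s =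
      ∫⁻ ω in pathsIn K n, extendZero (killedStep w (K n) g) (ω n) ∂pathLaw w s := by
  set κ : (n : ℕ) → Kernel (Π _ : Finset.Iic n, ChainState S) (ChainState S) := fun n =>
    (stepKernel w).comap
      (fun x : (Π _ : Finset.Iic n, ChainState S) => x ⟨n, Finset.mem_Iic.2 le_rfl⟩)
      (measurable_pi_apply _)
  have : ∀ n, IsMarkovKernel (κ n) := fun n => by
    simp only [κ]; infer_instance
  have hP : pathLaw w s = Kernel.traj (X := fun _ => ChainState S) κ 0
    (fun _ => alive s) := rfl
  -- The joint law of the history up to `n` and of the position at `n + 1` is a composition-product,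
  -- so the last coordinate can be integrated first.
  have key := Kernel.partialTraj_compProd_eq_map_traj (X := fun _ => ChainState S) (κ := κ)
    (Nat.zero_le n) (x₀ := fun _ => alive s)
  rw [← hP] at key
  have key2 := Kernel.traj_map_frestrictLe_apply (X := fun _ => ChainState S) (κ := κ) 0 n
    (fun _ => alive s)
  rw [← hP] at key2
  set A : Set (Π _ : Finset.Iic n, ChainState S) :=
    {x | ∀ m (h : m < n + 1), ∃ y ∈ K m, x ⟨m, Finset.mem_Iic.2 (Nat.lt_succ_iff.1 h)⟩ =
      (some y : Option S)}
  have hA : MeasurableSet A := by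
    have : A = ⋂ m, ⋂ h : m < n + 1,
        (fun x : (Π _ : Finset.Iic n, ChainState S) =>
          x ⟨m, Finset.mem_Iic.2 (Nat.lt_succ_iff.1 h)⟩) ⁻¹' {o | ∃ y ∈ K m, o = (some y : Option S)} := by
      ext; simp [A]
    rw [this]
    exact .iInter fun m => .iInter fun _ => (measurable_pi_apply _) trivial
  have hg : Measurable (extendZero g) := measurable_from_top
  have hF : Measurable fun p : (Π _ : Finset.Iic n, ChainState S) × ChainState S =>
      A.indicator 1 p.1 * extendZero g p.2 :=
    ((measurable_one.indicator hA).comp measurable_fst).mul (hg.comp measurable_snd)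
  have h1 : ∫⁻ ω in pathsIn K (n + 1), extendZero g (ω (n + 1)) ∂pathLaw w s =
      ∫⁻ p, A.indicator 1 p.1 * extendZero g p.2 ∂((pathLaw w s).map
        (fun x ↦ (Preorder.frestrictLe n x, x (n + 1)))) := by
    rw [lintegral_map hF (by fun_prop), ← lintegral_indicator (measurableSet_pathsIn _ _)]
    refine lintegral_congr fun ω => ?_
    by_cases hω : ω ∈ pathsIn K (n + 1)
    · have : Preorder.frestrictLe (π := fun _ => ChainState S) n ω ∈ A := fun m h => hω m h
      simp [hω, this]
    · have : Preorder.frestrictLe (π := fun _ => ChainState S) n ω ∉ A := fun h => hω fun m hm => h m hm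
      simp [hω, this]
  rw [h1, ← key, Measure.lintegral_compProd hF, ← key2]
  have h2 : ∀ x : (Π _ : Finset.Iic n, ChainState S),
      ∫⁻ y, A.indicator 1 x * extendZero g y ∂κ n x = A.indicator (fun x =>
        ∫⁻ y, extendZero g y ∂stepKernel w (x ⟨n, Finset.mem_Iic.2 le_rfl⟩)) x := by
    intro x
    rw [lintegral_const_mul _ hg]
    by_cases hx : x ∈ A <;> simp [hx, κ]
  simp only [h2]
  have hm : Measurable fun x : (Π _ : Finset.Iic n, ChainState S) =>
      ∫⁻ y, extendZero g y ∂stepKernel w (x ⟨n, Finset.mem_Iic.2 le_rfl⟩) :=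
    (measurable_from_top (f := fun o : ChainState S => ∫⁻ y, extendZero g y ∂stepKernel w o)).comp
      (measurable_pi_apply _)
  rw [lintegral_map (hm.indicator hA) (by fun_prop),
    ← lintegral_indicator (measurableSet_pathsIn _ _)]
  refine lintegral_congr fun ω => ?_
  by_cases hω : ω ∈ pathsIn K n
  · rw [Set.indicator_of_mem hω]
    rcases hn : ω n with _ | x
    · have : Preorder.frestrictLe (π := fun _ => ChainState S) n ω ∉ A := by
        intro h
        obtain ⟨y, _, hy⟩ := h n (Nat.lt_succ_self n)
        rw [Preorder.frestrictLe_apply] at hy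
        rw [hn] at hy
        exact Option.noConfusion rfl (heq_of_eq hy)
      rw [Set.indicator_of_notMem this]
      rfl
    · by_cases hx : x ∈ K n
      · have : Preorder.frestrictLe (π := fun _ => ChainState S) n ω ∈ A := by
          intro m h
          rcases Nat.lt_succ_iff_lt_or_eq.1 h with h | rfl
          · exact hω m h
          · exact ⟨x, hx, hn⟩
        rw [Set.indicator_of_mem this]
        simp only [Preorder.frestrictLe_apply]
        rw [hn]
        refine (lintegral_stepKernel_some (hw x) g).trans ?_
        simp [extendZero, killedStep, hx]
      · have : Preorder.frestrictLe (π := fun _ => ChainState S) n ω ∉ A := by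
          intro h
          obtain ⟨y, hyK, hy⟩ := h n (Nat.lt_succ_self n)
          rw [Preorder.frestrictLe_apply] at hy
          rw [hn] at hy
          exact hx (Option.some.inj hy ▸ hyK)
        rw [Set.indicator_of_notMem this]
        simp [extendZero, killedStep, hx]
  · have : Preorder.frestrictLe (π := fun _ => ChainState S) n ω ∉ A :=
      fun h => hω fun m hm => h m (hm.trans (Nat.lt_succ_self n))
    simp [hω, this]

theorem lintegral_pathLaw_zero (s : S) (K : ℕ → Set S) (g : S → ℝ≥0∞) :
    ∫⁻ ω in pathsIn K 0, extendZero g (ω 0) ∂pathLaw w s = g s := by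
  have h0 : pathsIn K 0 = Set.univ := by ext; simp [pathsIn]
  rw [h0, Measure.restrict_univ]
  set κ : (n : ℕ) → Kernel (Π _ : Finset.Iic n, ChainState S) (ChainState S) := fun n =>
    (stepKernel w).comap
      (fun x : (Π _ : Finset.Iic n, ChainState S) => x ⟨n, Finset.mem_Iic.2 le_rfl⟩)
      (measurable_pi_apply _)
  have hm : Measurable fun ω : ℕ → ChainState S => extendZero g (ω 0) :=
    (measurable_from_top (f := extendZero g)).comp (measurable_pi_apply 0)
  have hP : pathLaw w s = Kernel.traj (X := fun _ => ChainState S) κ 0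
    (fun _ => alive s) := rfl
  rw [hP, Kernel.lintegral_traj _ hm]
  have : ∀ x : ℕ → ChainState S, extendZero g (Function.updateFinset x (Finset.Iic 0)
      (fun _ => alive s) 0) = g s := by
    intro x
    simp [Function.updateFinset, extendZero, alive]
  simp [this]

theorem measurableSet_firstSteps (K K' T : Set S) (n : ℕ) :
    MeasurableSet {ω : ℕ → ChainState S | AtTime ω (n + 1) T ∧ AtTime ω 0 K ∧
        ∀ m, 1 ≤ m → m < n + 1 → AtTime ω m K'} := by
  refine (measurableSet_atTime _ _).inter ((measurableSet_atTime _ _).inter ?_)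
  have : {ω : ℕ → ChainState S | ∀ m, 1 ≤ m → m < n + 1 → AtTime ω m K'} =
      ⋂ m, ⋂ _ : 1 ≤ m, ⋂ _ : m < n + 1, {ω | AtTime ω m K'} := by
    ext; simp
  change MeasurableSet {ω : ℕ → ChainState S | ∀ m, 1 ≤ m → m < n + 1 → AtTime ω m K'}
  rw [this]
  exact .iInter fun m => .iInter fun _ => .iInter fun _ => measurableSet_atTime m K'

/-- The probability of a path constrained to be in `K` at time `0`, in `K'` at times
`1, …, n - 1`, and in `T` at time `n`. -/
theorem pathLaw_firstSteps (hw : ∀ s, ∑' t, w s t ≤ 1) (s : S) (K K' T : Set S) (n : ℕ) :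
    pathLaw w s {ω | AtTime ω (n + 1) T ∧ AtTime ω 0 K ∧
        ∀ m, 1 ≤ m → m < n + 1 → AtTime ω m K'} =
      killedStep w K ((killedStep w K')^[n] (T.indicator 1)) s := by
  -- Time `0` gets its own constraint because the starting vertex may itself be one of the vertices
  -- avoided later.
  set L : ℕ → Set S := fun m => if m = 0 then K else K'
  have h1 : ∀ (n : ℕ) (g : S → ℝ≥0∞),
      ∫⁻ ω in pathsIn L (n + 1), extendZero g (ω (n + 1)) ∂pathLaw w s =
        killedStep w K ((killedStep w K')^[n] g) s := by
    intro n
    induction n with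
    | zero => intro g; rw [lintegral_pathsIn_succ hw, lintegral_pathLaw_zero]; simp [L]
    | succ n ih =>
      intro g
      rw [lintegral_pathsIn_succ hw, ih, Function.iterate_succ_apply]
      simp [L]
  rw [← h1, ← lintegral_indicator (measurableSet_pathsIn _ _), ← lintegral_indicator_one]
  · refine lintegral_congr fun ω => ?_
    have hiff : ω ∈ pathsIn L (n + 1) ↔ AtTime ω 0 K ∧
        ∀ m, 1 ≤ m → m < n + 1 → AtTime ω m K' := by
      refine ⟨fun h => ⟨by simpa [L] using h 0 (Nat.succ_pos n), fun m h1 h2 => ?_⟩,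
        fun h m hm => ?_⟩
      · have := h m h2
        simpa [L, Nat.one_le_iff_ne_zero.1 h1] using this
      · rcases Nat.eq_zero_or_pos m with rfl | hpos
        · simpa [L] using h.1
        · simpa [L, hpos.ne'] using h.2 m hpos hm
    by_cases hω : ω ∈ pathsIn L (n + 1)
    · rw [Set.indicator_of_mem hω, extendZero_indicator]
      have h := hiff.1 hω
      refine Set.indicator_eq_indicator ⟨fun h' => h'.1, fun h' => ⟨h', h⟩⟩ rfl
    · rw [Set.indicator_of_notMem hω, Set.indicator_of_notMem]
      exact fun h => hω (hiff.2 h.2)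
  · exact measurableSet_firstSteps K K' T n

theorem pathLaw_atTime_zero (s : S) (T : Set S) :
    pathLaw w s {ω | AtTime ω 0 T} = T.indicator 1 s := by
  rw [← lintegral_pathLaw_zero (w := w) s (fun _ => T) (T.indicator 1), ← lintegral_indicator_one
    (measurableSet_atTime 0 T)]
  have h0 : pathsIn (fun _ => T) 0 = Set.univ := by ext; simp [pathsIn]
  rw [h0, Measure.restrict_univ]
  refine lintegral_congr fun ω => (extendZero_indicator ω 0 T).symm

theorem atTime_diff {ω : ℕ → ChainState S} {n : ℕ} {U U' : Set S} :
    AtTime ω n (U \ U') ↔ AtTime ω n U ∧ ¬ AtTime ω n U' := by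
  constructor
  · rintro ⟨x, hx, h⟩
    refine ⟨⟨x, hx.1, h⟩, ?_⟩
    rintro ⟨y, hy, h'⟩
    exact hx.2 (Option.some.inj (h.symm.trans h') ▸ hy)
  · rintro ⟨⟨x, hx, h⟩, h'⟩
    exact ⟨x, ⟨hx, fun hx' => h' ⟨x, hx', h⟩⟩, h⟩

instance (s : S) : IsProbabilityMeasure (pathLaw w s) := by
  set κ : (n : ℕ) → Kernel (Π _ : Finset.Iic n, ChainState S) (ChainState S) := fun n =>
    (stepKernel w).comap
      (fun x : (Π _ : Finset.Iic n, ChainState S) => x ⟨n, Finset.mem_Iic.2 le_rfl⟩)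
      (measurable_pi_apply _)
  have : ∀ n, IsMarkovKernel (κ n) := fun n => by
    simp only [κ]; infer_instance
  have h : IsMarkovKernel (Kernel.traj (X := fun _ => ChainState S) κ 0) := inferInstance
  exact h.isProbabilityMeasure fun _ => alive s

theorem reward_top (K : Set S) (g : S → ℝ≥0∞) (s : S) :
    reward w ⊤ K g s = ∑' k : ℕ, (killedStep w K)^[k] g s := by
  simp [reward]

theorem killedStep_tsum {ι : Type*} (K : Set S) (f : ι → S → ℝ≥0∞) (s : S) :
    killedStep w K (fun t => ∑' i, f i t) s = ∑' i, killedStep w K (f i) s := by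
  by_cases hs : s ∈ K
  · simp only [killedStep, Set.indicator_of_mem hs, ← ENNReal.tsum_mul_left]
    exact ENNReal.tsum_comm
  · simp [killedStep, hs]

/-- Since `K'` misses `T`, at most one time `n` can work, so the events are disjoint and their
probabilities add up to a reward. -/
theorem pathLaw_firstSteps_iUnion (hw : ∀ s, ∑' t, w s t ≤ 1) (s : S) {K K' T : Set S}
    (hT : Disjoint K' T) :
    pathLaw w s {ω | ∃ n, AtTime ω (n + 1) T ∧ AtTime ω 0 K ∧
        ∀ m, 1 ≤ m → m < n + 1 → AtTime ω m K'} =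
      killedStep w K (reward w ⊤ K' (T.indicator 1)) s := by
  rw [Set.ofPred_exists, measure_iUnion _ fun n => measurableSet_firstSteps K K' T n]
  · simp only [pathLaw_firstSteps hw, ← killedStep_tsum, ← reward_top]
  · have key : ∀ {m n : ℕ} {ω : ℕ → ChainState S}, m < n → AtTime ω (m + 1) T →
        (∀ m, 1 ≤ m → m < n + 1 → AtTime ω m K') → False := by
      intro m n ω hmn h1 h2
      obtain ⟨x, hx, h⟩ := h1
      obtain ⟨y, hy, h'⟩ := h2 (m + 1) (Nat.succ_pos m) (Nat.succ_lt_succ hmn)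
      exact Set.disjoint_left.1 hT hy (Option.some.inj (h'.symm.trans h) ▸ hx)
    intro m n hmn
    refine Set.disjoint_left.2 fun ω h h' => ?_
    rcases lt_or_gt_of_ne hmn with hlt | hlt
    · exact key hlt h.1 h'.2.2
    · exact key hlt h'.1 h.2.2

/-- A witnessing time may be replaced by the first visit to `T`; this makes it unique and turns `K`
into `K \ T`. The case of a start in `T` is split off because avoidance of `X` only begins at time
`1`. -/
theorem ofReal_probUntilAvoiding (hw : ∀ s, ∑' t, w s t ≤ 1) (s : S) (K T X : Set S) :
    ENNReal.ofReal (probUntilAvoiding w s K T X) = T.indicator 1 s +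
      killedStep w (K \ T) (reward w ⊤ ((K \ T) \ X) ((T \ X).indicator 1)) s := by
  rw [← pathLaw_firstSteps_iUnion hw s (Set.disjoint_left.2 fun x h h' => h.1.2 h'.1),
    ← pathLaw_atTime_zero (w := w) s T, ← measure_union, probUntilAvoiding,
    ofReal_measureReal]
  · congr 1
    ext ω
    simp only [Set.mem_ofPred_eq, Set.mem_union, atTime_diff]
    constructor
    · rintro ⟨n, hn⟩
      classical
      have hex : ∃ n, AtTime ω n T := ⟨n, hn.1⟩
      have hle := Nat.find_min' hex hn.1
      have hfind := Nat.find_spec hex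
      have hmin := fun m => Nat.find_min (H := hex) (m := m)
      generalize Nat.find hex = k at hle hfind hmin
      rcases k with _ | k
      · exact Or.inl hfind
      · refine Or.inr ⟨k, ⟨hfind, hn.2.2 _ (Nat.succ_pos k) hle⟩,
          ⟨hn.2.1 0 (by lia), hmin 0 (by lia)⟩, fun m h1 h2 =>
          ⟨⟨hn.2.1 m (by lia), hmin m (by lia)⟩, hn.2.2 m h1 (by lia)⟩⟩
    · rintro (h | ⟨n, h1, h2, h3⟩)
      · exact ⟨0, h, by lia, by lia⟩
      · refine ⟨n + 1, h1.1, fun m hm => ?_, fun m hm hm' => ?_⟩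
        · rcases Nat.eq_zero_or_pos m with rfl | hpos
          · exact h2.1
          · exact (h3 m hpos hm).1.1
        · rcases Nat.lt_or_eq_of_le hm' with h | rfl
          · exact (h3 m hm h).2
          · exact h1.2
  · refine Set.disjoint_left.2 fun ω h h' => ?_
    obtain ⟨n, _, h2, _⟩ := h'
    exact (atTime_diff.1 h2).2 h
  · rw [Set.ofPred_exists]
    exact .iUnion fun n => measurableSet_firstSteps _ _ _ n

/-- As `t` belongs to `X`, avoiding `X` at intermediate positive times already makes the hitting
time unique. -/
theorem ofReal_probFirstHit (hw : ∀ s, ∑' t, w s t ≤ 1) (s : S) (K X : Set S) {t : S}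
    (ht : t ∈ X) :
    ENNReal.ofReal (probFirstHit w s K X t) =
      killedStep w K (reward w ⊤ (K \ X) (({t} : Set S).indicator 1)) s := by
  rw [← pathLaw_firstSteps_iUnion hw s (Set.disjoint_left.2 fun x h h' => h.2 (h' ▸ ht)),
    probFirstHit, ofReal_measureReal]
  congr 1
  ext ω
  simp only [Set.mem_ofPred_eq, atTime_diff]
  constructor
  · rintro ⟨n, hn, h1, h2, h3⟩
    obtain ⟨n, rfl⟩ := Nat.exists_eq_add_of_le' hn
    exact ⟨n, h1, h2 0 hn, fun m hm hm' => ⟨h2 m hm', h3 m hm hm'⟩⟩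
  · rintro ⟨n, h1, h2, h3⟩
    refine ⟨n + 1, Nat.succ_pos n, h1, fun m hm => ?_, fun m hm hm' => (h3 m hm hm').2⟩
    rcases Nat.eq_zero_or_pos m with rfl | hpos
    · exact h2
    · exact (h3 m hpos hm).1

theorem reward_succ (n : ℕ∞) (K : Set S) (g : S → ℝ≥0∞) (s : S) :
    reward w (n + 1) K g s = g s + killedStep w K (reward w n K g) s := by
  have h : ∀ k : ℕ, ((k + 1 : ℕ) : ℕ∞) < n + 1 ↔ (k : ℕ∞) < n := fun k => by
    rw [Nat.cast_add_one, ENat.add_lt_add_iff_right (by simp)]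
  unfold reward
  rw [tsum_eq_zero_add' ENNReal.summable, killedStep_tsum]
  congr 1
  · simp
  · refine tsum_congr fun k => ?_
    simp only [h, Function.iterate_succ_apply']
    split_ifs with hk
    · rfl
    · simp [killedStep]

theorem ofReal_probUntil (hw : ∀ s, ∑' t, w s t ≤ 1) (s : S) (K T : Set S) :
    ENNReal.ofReal (probUntil w s K T) = reward w ⊤ (K \ T) (T.indicator 1) s := by
  have h : probUntil w s K T = probUntilAvoiding w s K T ∅ := by
    have : ∀ (ω : ℕ → ChainState S) n, ¬ AtTime ω n ∅ := fun ω n ⟨x, hx, _⟩ => hx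
    simp only [probUntil, probUntilAvoiding, this, not_false_eq_true, implies_true, and_true]
  rw [h, ofReal_probUntilAvoiding hw, Set.sdiff_empty, Set.sdiff_empty, ← reward_succ, top_add]

end

/-! ### Algebra of rewards -/

section
variable {S : Type*} {w : S → S → ℝ≥0∞}

theorem killedStep_mono (K : Set S) {g g' : S → ℝ≥0∞} (h : g ≤ g') :
    killedStep w K g ≤ killedStep w K g' := fun s => by
  by_cases hs : s ∈ K
  · simp only [killedStep, Set.indicator_of_mem hs]
    exact ENNReal.tsum_le_tsum fun t => mul_le_mul_right (h t) _
  · simp [killedStep, hs]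

theorem killedStep_add (K : Set S) (g g' : S → ℝ≥0∞) :
    killedStep w K (g + g') = killedStep w K g + killedStep w K g' := by
  ext s
  by_cases hs : s ∈ K
  · simp [killedStep, hs, mul_add, ENNReal.tsum_add]
  · simp [killedStep, hs]

theorem killedStep_const_mul (K : Set S) (c : ℝ≥0∞) (g : S → ℝ≥0∞) (s : S) :
    killedStep w K (fun t => c * g t) s = c * killedStep w K g s := by
  by_cases hs : s ∈ K
  · simp [killedStep, hs, mul_left_comm, ENNReal.tsum_mul_left]
  · simp [killedStep, hs]

theorem killedStep_linear {ι : Type*} (K : Set S) (g : S → ℝ≥0∞) (c : ι → ℝ≥0∞)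
    (f : ι → S → ℝ≥0∞) (s : S) :
    killedStep w K (fun t => g t + ∑' i, c i * f i t) s =
      killedStep w K g s + ∑' i, c i * killedStep w K (f i) s := by
  refine (congrFun (killedStep_add K g fun t => ∑' i, c i * f i t) s).trans ?_
  rw [Pi.add_apply, killedStep_tsum]
  simp only [killedStep_const_mul]

theorem reward_linear {ι : Type*} (n : ℕ∞) (K : Set S) (g : S → ℝ≥0∞) (c : ι → ℝ≥0∞)
    (f : ι → S → ℝ≥0∞) (s : S) :
    reward w n K (fun t => g t + ∑' i, c i * f i t) s =
      reward w n K g s + ∑' i, c i * reward w n K (f i) s := by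
  have h : ∀ k : ℕ, (killedStep w K)^[k] (fun t => g t + ∑' i, c i * f i t) =
      fun t => (killedStep w K)^[k] g t + ∑' i, c i * (killedStep w K)^[k] (f i) t := by
    intro k
    induction k with
    | zero => rfl
    | succ k ih =>
      rw [Function.iterate_succ_apply', ih]
      ext t
      simp only [killedStep_linear, Function.iterate_succ_apply']
  unfold reward
  simp only [h, ← ENNReal.tsum_mul_left]
  rw [ENNReal.tsum_comm, ← ENNReal.tsum_add]
  refine tsum_congr fun k => ?_
  split_ifs <;> simp

theorem reward_mono_left {m n : ℕ∞} (h : m ≤ n) (K : Set S) (g : S → ℝ≥0∞) :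
    reward w m K g ≤ reward w n K g := fun s =>
  ENNReal.tsum_le_tsum fun k => by
    by_cases hk : (k : ℕ∞) < m
    · simp [hk, hk.trans_le h]
    · simp [hk]

theorem reward_zero (K : Set S) (g : S → ℝ≥0∞) : reward w 0 K g = 0 := by
  ext s; simp [reward]

theorem reward_top_eq_iSup (K : Set S) (g : S → ℝ≥0∞) (s : S) :
    reward w ⊤ K g s = ⨆ n : ℕ, reward w n K g s := by
  rw [reward_top, ENNReal.tsum_eq_iSup_nat]
  refine iSup_congr fun n => ?_
  rw [reward, tsum_eq_sum (s := Finset.range n)]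
  · exact Finset.sum_congr rfl fun k hk => by simp [Finset.mem_range.1 hk]
  · intro k hk
    simp [not_lt.2 (not_lt.1 fun h => hk (Finset.mem_range.2 h))]

theorem reward_of_notMem (n : ℕ∞) {K : Set S} (g : S → ℝ≥0∞) {s : S} (hs : s ∉ K) :
    reward w (n + 1) K g s = g s := by
  rw [reward_succ, killedStep, Set.indicator_of_notMem hs, add_zero]

theorem reward_le_of_notMem (n : ℕ∞) {K : Set S} (g : S → ℝ≥0∞) {s : S} (hs : s ∉ K) :
    reward w n K g s ≤ g s :=
  (reward_mono_left le_top K g s).trans (by rw [← top_add (1 : ℕ∞), reward_of_notMem _ _ hs])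

theorem reward_zero_right (n : ℕ∞) (K : Set S) : reward w n K 0 = 0 := by
  ext s
  refine ENNReal.tsum_eq_zero.2 fun k => ?_
  have h : (killedStep w K)^[k] 0 = 0 := by
    induction k with
    | zero => rfl
    | succ k ih =>
      rw [Function.iterate_succ_apply', ih]
      ext t
      simp [killedStep]
  simp [h]

/-- Transfer of rewards along a map that preserves the transitions on a closed region. -/
theorem reward_transfer {S' : Type*} {w' : S' → S' → ℝ≥0∞} (φ : S → S') (C : Set S)
    {K : Set S} {K' : Set S'} {g : S → ℝ≥0∞} {g' : S' → ℝ≥0∞}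
    (hK : ∀ s ∈ C, φ s ∈ K' ↔ s ∈ K) (hg : ∀ s ∈ C, g' (φ s) = g s)
    (hw : ∀ s ∈ C, s ∈ K → ∀ f : S' → ℝ≥0∞, ∑' t, w' (φ s) t * f t = ∑' t, w s t * f (φ t))
    (hC : ∀ s ∈ C, s ∈ K → ∀ t, w s t ≠ 0 → t ∈ C) (n : ℕ∞) {s : S} (hs : s ∈ C) :
    reward w' n K' g' (φ s) = reward w n K g s := by
  have h : ∀ k : ℕ, ∀ s ∈ C, (killedStep w' K')^[k] g' (φ s) = (killedStep w K)^[k] g s := by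
    intro k
    induction k with
    | zero => exact hg
    | succ k ih =>
      intro s hs
      rw [Function.iterate_succ_apply', Function.iterate_succ_apply']
      by_cases hsK : s ∈ K
      · rw [killedStep, killedStep, Set.indicator_of_mem ((hK s hs).2 hsK),
          Set.indicator_of_mem hsK, hw s hs hsK]
        refine tsum_congr fun t => ?_
        by_cases ht : w s t = 0
        · simp [ht]
        · rw [ih t (hC s hs hsK t ht)]
      · rw [killedStep, killedStep, Set.indicator_of_notMem (fun h => hsK ((hK s hs).1 h)),
          Set.indicator_of_notMem hsK]
  unfold reward
  exact tsum_congr fun k => by rw [h k s hs]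

/-- The reward of a chain, stopped on `P` where the expected further reward is `f`. -/
noncomputable def stopAt (P : Set S) (g f : S → ℝ≥0∞) : S → ℝ≥0∞ :=
  Pᶜ.indicator g + P.indicator f

theorem stopAt_of_mem {P : Set S} (g f : S → ℝ≥0∞) {s : S} (h : s ∈ P) :
    stopAt P g f s = f s := by simp [stopAt, h]

theorem stopAt_of_notMem {P : Set S} (g f : S → ℝ≥0∞) {s : S} (h : s ∉ P) :
    stopAt P g f s = g s := by simp [stopAt, h]

/-- A path of length below `k` splits at its first visit to `P` into two pieces of length below `k`.
The separate horizons are for the induction: `k` and `m` drop at each step while `n`, fixed inside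
the stopping reward, must not. -/
theorem reward_le_stopped_of_le {m n : ℕ∞} (k : ℕ) (hk : k ≤ m) (hn : (k : ℕ∞) ≤ n) (K P : Set S)
    (g : S → ℝ≥0∞) :
    reward w k K g ≤ reward w m (K \ P) (stopAt P g (reward w n K g)) := by
  induction k generalizing m with
  | zero => rw [Nat.cast_zero, reward_zero]; exact zero_le
  | succ k ih =>
    intro s
    rw [Nat.cast_add_one] at hk hn ⊢
    obtain ⟨m, rfl⟩ : ∃ m', m = m' + 1 :=
      ⟨m - 1, (tsub_add_cancel_of_le (le_add_self.trans hk)).symm⟩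
    have hkm : (k : ℕ∞) ≤ m := (ENat.add_le_add_iff_right (by simp)).1 hk
    by_cases hs : s ∈ P
    · rw [reward_of_notMem (K := K \ P) m _ fun h => h.2 hs, stopAt_of_mem _ _ hs]
      exact reward_mono_left hn K g s
    · rw [reward_succ, reward_succ, stopAt_of_notMem _ _ hs]
      refine add_le_add_right ?_ _
      refine (killedStep_mono K (ih hkm (le_self_add.trans hn)) s).trans (le_of_eq ?_)
      by_cases hK : s ∈ K <;> simp [killedStep, hK, hs]

theorem stopped_reward_le {n : ℕ} (K P : Set S) (g : S → ℝ≥0∞) :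
    reward w n (K \ P) (stopAt P g (reward w ⊤ K g)) ≤ reward w ⊤ K g := by
  induction n with
  | zero => rw [Nat.cast_zero, reward_zero]; exact zero_le
  | succ n ih =>
    intro s
    rw [Nat.cast_add_one]
    by_cases hs : s ∈ P
    · rw [reward_of_notMem _ _ fun h => h.2 hs, stopAt_of_mem _ _ hs]
    · rw [reward_succ, stopAt_of_notMem _ _ hs, ← top_add (1 : ℕ∞), reward_succ, top_add]
      refine add_le_add_right ?_ _
      refine le_trans (le_of_eq ?_) (killedStep_mono K ih s)
      by_cases hK : s ∈ K <;> simp [killedStep, hK, hs]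

/-- The strong Markov property at the hitting time of `P`. -/
theorem reward_stopped (K P : Set S) (g : S → ℝ≥0∞) :
    reward w ⊤ (K \ P) (stopAt P g (reward w ⊤ K g)) = reward w ⊤ K g := by
  refine le_antisymm (fun s => ?_) fun s => ?_
  · rw [reward_top_eq_iSup]
    exact iSup_le fun n => stopped_reward_le K P g s
  · rw [reward_top_eq_iSup K g]
    exact iSup_le fun n => reward_le_stopped_of_le n le_top le_top K P g s

/-- Finite-horizon substitute for strong Markov, the source of minimality. It is only an inequality:
on the right each of the two pieces may use the whole horizon. -/
theorem reward_le_stopped (n : ℕ) (K P : Set S) (g : S → ℝ≥0∞) :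
    reward w n K g ≤ reward w n (K \ P) (stopAt P g (reward w n K g)) :=
  reward_le_stopped_of_le n le_rfl le_rfl K P g

theorem indicator_range_eq_tsum {ι : Type*} {q : ι → S} (hq : Function.Injective q)
    (f : S → ℝ≥0∞) (s : S) :
    (Set.range q).indicator f s = ∑' i, f (q i) * ({q i} : Set S).indicator 1 s := by
  by_cases hs : s ∈ Set.range q
  · obtain ⟨i, rfl⟩ := hs
    rw [tsum_eq_single i]
    · simp
    · intro j hj
      have : q i ≠ q j := fun h => hj (hq h).symm
      simp [this]
  · rw [Set.indicator_of_notMem hs]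
    symm
    refine ENNReal.tsum_eq_zero.2 fun i => ?_
    have : s ≠ q i := fun h => hs ⟨i, h.symm⟩
    simp [this]

end

/-! ### Weights and graph morphisms -/

section
variable {N T₁ T₂ V V' : Type*} {ar : N → ℕ} [Fintype T₂] (μ : T₂ → Set.Icc (0 : ℝ) 1)

theorem ColHypergraph.tsum_weight_mul (H : ColHypergraph ar T₁ T₂ V) (s : V) (f : V → ℝ≥0∞) :
    ∑' t, H.weight μ s t * f t =
      ∑ a, ENNReal.ofReal (μ a) * ∑' t, {t | (a, s, t) ∈ H.arc}.indicator f t := by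
  simp only [← ENNReal.tsum_mul_left]
  rw [← Summable.tsum_finsetSum fun a _ => ENNReal.summable]
  refine tsum_congr fun t => ?_
  rw [weight, Finset.sum_mul]
  refine Finset.sum_congr rfl fun a _ => ?_
  by_cases h : (a, s, t) ∈ H.arc <;> simp [h]

theorem ColHypergraph.tsum_weight (H : ColHypergraph ar T₁ T₂ V) (s : V) :
    ∑' t, H.weight μ s t =
      ∑ a, ENNReal.ofReal (μ a) * (({t | (a, s, t) ∈ H.arc} : Set V).encard : ℝ≥0∞) := by
  have h := H.tsum_weight_mul μ s 1
  simp only [Pi.one_apply, mul_one] at h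
  rw [h]
  refine Finset.sum_congr rfl fun a _ => ?_
  rw [← tsum_subtype, ← ENNReal.tsum_set_one]
  rfl

theorem ColHypergraph.tsum_weight_map {H : ColHypergraph ar T₁ T₂ V}
    {H' : ColHypergraph ar T₁ T₂ V'} {φ : V → V'} (hφ : Function.Injective φ) {s : V}
    (h : ∀ a t', (a, φ s, t') ∈ H'.arc ↔ ∃ t, φ t = t' ∧ (a, s, t) ∈ H.arc) (f : V' → ℝ≥0∞) :
    ∑' t, H'.weight μ (φ s) t * f t = ∑' t, H.weight μ s t * f (φ t) := by
  rw [tsum_weight_mul, tsum_weight_mul]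
  refine Finset.sum_congr rfl fun a _ => ?_
  congr 1
  rw [← hφ.tsum_eq]
  · refine tsum_congr fun t => ?_
    refine Set.indicator_eq_indicator ?_ rfl
    simp only [Set.mem_ofPred_eq, h]
    exact ⟨fun ⟨t', ht, h'⟩ => hφ ht ▸ h', fun h' => ⟨t, rfl, h'⟩⟩
  · intro t' ht'
    obtain ⟨t, ht, _⟩ := (h a t').1 (Set.mem_of_indicator_ne_zero
      (s := {t | (a, φ s, t) ∈ H'.arc}) (f := f) ht')
    exact ⟨t, ht⟩

theorem ColHypergraph.tsum_weight_le {H : ColHypergraph ar T₁ T₂ V}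
    {H' : ColHypergraph ar T₁ T₂ V'} {φ : V → V'} (hφ : Function.Injective φ)
    (h : ∀ a s t, (a, s, t) ∈ H.arc → (a, φ s, φ t) ∈ H'.arc) (s : V) :
    ∑' t, H.weight μ s t ≤ ∑' t, H'.weight μ (φ s) t := by
  refine le_trans (ENNReal.tsum_le_tsum fun t => ?_) (ENNReal.tsum_comp_le_tsum_of_injective hφ _)
  refine Finset.sum_le_sum fun a _ => ?_
  by_cases h' : (a, s, t) ∈ H.arc
  · rw [if_pos h', if_pos (h a s t h')]
  · rw [if_neg h']; exact zero_le

theorem ColHypergraph.exists_arc_of_weight_ne_zero {H : ColHypergraph ar T₁ T₂ V} {s t : V}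
    (h : H.weight μ s t ≠ 0) : ∃ a, (a, s, t) ∈ H.arc := by
  by_contra! h'
  exact h (Finset.sum_eq_zero fun a _ => if_neg (h' a))

end

namespace HRGrammar

variable {N T₁ T₂ : Type*} {G : HRGrammar N T₁ T₂}

/-! ### Occurrences and placements -/

/-- Concatenation of occurrences. -/
def Occ.append {A B : N} (X : G.Occ A B) : {C : N} → G.Occ B C → G.Occ A C
  | _, .root => X
  | _, .child Y e => (X.append Y).child e

theorem Occ.depth_append {A B C : N} (X : G.Occ A B) (Y : G.Occ B C) :
    (X.append Y).depth = X.depth + Y.depth := by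
  induction Y with
  | root => rfl
  | child Y e ih => simp only [Occ.append, Occ.depth, ih]; lia

/-- The sequence of hyperarcs followed by an occurrence, the last one first. -/
def Occ.code {A : N} : {B : N} → G.Occ A B → List (Σ B : N, G.Arc B)
  | _, .root => []
  | _, .child X e => ⟨_, e⟩ :: X.code

theorem Occ.code_append {A B C : N} (X : G.Occ A B) (Y : G.Occ B C) :
    (X.append Y).code = Y.code ++ X.code := by
  induction Y with
  | root => rfl
  | child Y e ih => simp only [Occ.append, Occ.code, ih, List.cons_append]

/-- Encoding occurrences as plain lists avoids casts between the types `G.Occ A B`; it reduces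
cancellation of a common initial occurrence to cancellation in lists. -/
theorem Occ.sigma_eq_of_code_eq {A B B' : N} (X : G.Occ A B) (X' : G.Occ A B')
    (h : X.code = X'.code) : (⟨B, X⟩ : Σ B, G.Occ A B) = ⟨B', X'⟩ := by
  induction X generalizing B' with
  | root =>
    cases X' with
    | root => rfl
    | child X' e => simp [Occ.code] at h
  | child X e ih =>
    cases X' with
    | root => simp [Occ.code] at h
    | child X' e' =>
      simp only [Occ.code, List.cons.injEq] at h
      cases ih X' h.2
      cases h.1
      rfl

theorem Occ.code_eq_of_sigma_eq {A B B' : N} {X : G.Occ A B} {X' : G.Occ A B'}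
    (h : (⟨B, X⟩ : Σ B, G.Occ A B) = ⟨B', X'⟩) : X.code = X'.code :=
  congrArg (fun p : Σ B, G.Occ A B => p.2.code) h

theorem Occ.root_append {A B : N} (X : G.Occ A B) : (Occ.root : G.Occ A A).append X = X := by
  induction X with
  | root => rfl
  | child X e ih => rw [Occ.append, ih]

/-- The vertex at position `j` of the initial hyperarc. -/
def Vertex.input {A : N} (j : Fin (G.ar A)) : G.Vertex A := .inl j

theorem Vertex.input_injective {A : N} : Function.Injective (Vertex.input (G := G) (A := A)) :=
  Sum.inl_injective

theorem Vertex.lev_input {A : N} (j : Fin (G.ar A)) : (Vertex.input j).lev = 0 := rfl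

theorem Occ.place_of_notMem {A B : N} (X : G.Occ A B) {v : G.V B}
    (h : v ∉ Set.range (G.inp B)) : X.place v = .inr ⟨B, X, v, h⟩ := by
  cases X with
  | root => rw [Occ.place]; exact dif_neg h
  | child X e => rw [Occ.place]; exact dif_neg h

theorem Occ.place_root_inp {A : N} (j : Fin (G.ar A)) :
    (Occ.root : G.Occ A A).place (G.inp A j) = Vertex.input j := by
  have h : G.inp A j ∈ Set.range (G.inp A) := ⟨j, rfl⟩
  rw [Occ.place]
  exact (dif_pos h).trans (congrArg Sum.inl ((G.inp A).injective h.choose_spec))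

theorem Occ.place_child_inp {A B : N} (X : G.Occ A B) (e : G.Arc B) (j : Fin (G.ar e.lab)) :
    (X.child e).place (G.inp e.lab j) = X.place (e.att j) := by
  have h : G.inp e.lab j ∈ Set.range (G.inp e.lab) := ⟨j, rfl⟩
  rw [Occ.place]
  exact (dif_pos h).trans
    (congrArg (fun j => X.place (e.att j)) ((G.inp e.lab).injective h.choose_spec))

theorem IsOutside.att_notMem (hG : G.IsOutside) {A : N} (e : G.Arc A) (i : Fin (G.ar e.lab)) :
    e.att i ∉ Set.range (G.inp A) := fun ⟨j, hj⟩ => hG.output_ne_input A e i j hj.symm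

theorem IsOutside.att_inj (hG : G.IsOutside) {A : N} {e e' : G.Arc A} {i : Fin (G.ar e.lab)}
    {i' : Fin (G.ar e'.lab)} (h : e.att i = e'.att i') :
    (⟨e, i⟩ : Σ e : G.Arc A, Fin (G.ar e.lab)) = ⟨e', i'⟩ := by
  cases hG.unique_arc A e e' i i' h
  cases hG.att_injective A e h
  rfl

theorem IsOutside.place_att (hG : G.IsOutside) {A B : N} (X : G.Occ A B) (e : G.Arc B)
    (i : Fin (G.ar e.lab)) : X.place (e.att i) = .inr ⟨B, X, e.att i, hG.att_notMem e i⟩ :=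
  X.place_of_notMem (hG.att_notMem e i)

/-- The occurrences through a vertex: the one that creates it and, if it is an output, the one of
the hyperarc on which it lies. -/
theorem IsOutside.place_cases (hG : G.IsOutside) {A C : N}
    {motive : ∀ B, G.Occ A B → G.V B → Prop} {Y : G.Occ A C} {v : G.V C}
    (hv : v ∉ Set.range (G.inp C)) (h1 : motive C Y v)
    (h2 : ∀ (e : G.Arc C) l, e.att l = v → motive e.lab (Y.child e) (G.inp e.lab l))
    {B : N} (X : G.Occ A B) (u : G.V B) (h : X.place u = Y.place v) : motive B X u := by
  rw [Y.place_of_notMem hv] at h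
  by_cases hu : u ∈ Set.range (G.inp B)
  · obtain ⟨j, rfl⟩ := hu
    cases X with
    | root => rw [Occ.place_root_inp] at h; exact absurd h Sum.inl_ne_inr
    | child X e =>
      rw [Occ.place_child_inp, hG.place_att] at h
      cases Sum.inr.inj h
      exact h2 e j rfl
  · rw [X.place_of_notMem hu] at h
    cases Sum.inr.inj h
    exact h1

theorem IsOutside.lev_place_inp_le (hG : G.IsOutside) {A B : N} (X : G.Occ A B)
    (j : Fin (G.ar B)) : (X.place (G.inp B j)).lev ≤ X.depth := by
  cases X with
  | root => rw [Occ.place_root_inp]; rfl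
  | child X e => rw [Occ.place_child_inp, hG.place_att]; rfl

/-- Levels separate inputs (at most `X.depth`) from fresh vertices (`X.depth + 1`). Two inputs of a
rewritten hyperarc are told apart by the injectivity of its attachment. -/
theorem IsOutside.place_injective (hG : G.IsOutside) {A B : N} (X : G.Occ A B) :
    Function.Injective X.place := by
  have mixed : ∀ {A B : N} (X : G.Occ A B) (j : Fin (G.ar B)) (v : G.V B),
      v ∉ Set.range (G.inp B) → X.place (G.inp B j) ≠ X.place v := by
    intro A B X j v hv h
    have := hG.lev_place_inp_le X j
    rw [h, X.place_of_notMem hv] at this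
    exact Nat.not_succ_le_self _ this
  have inputs : ∀ j j', X.place (G.inp B j) = X.place (G.inp B j') → j = j' := by
    cases X with
    | root =>
      intro j j' h
      rw [Occ.place_root_inp, Occ.place_root_inp] at h
      exact Sum.inl.inj h
    | child X e =>
      intro j j' h
      rw [Occ.place_child_inp, Occ.place_child_inp, hG.place_att, hG.place_att] at h
      have h' := Sum.inr.inj h
      simp only [Sigma.mk.injEq, heq_eq_eq, Prod.mk.injEq, Subtype.mk.injEq, true_and] at h'
      exact hG.att_injective _ e h'
  intro u v h
  by_cases hu : u ∈ Set.range (G.inp B) <;> by_cases hv : v ∈ Set.range (G.inp B)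
  · obtain ⟨j, rfl⟩ := hu
    obtain ⟨j', rfl⟩ := hv
    rw [inputs j j' h]
  · obtain ⟨j, rfl⟩ := hu
    exact absurd h (mixed X j v hv)
  · obtain ⟨j, rfl⟩ := hv
    exact absurd h.symm (mixed X j u hu)
  · rw [X.place_of_notMem hu, X.place_of_notMem hv] at h
    have h' := Sum.inr.inj h
    simpa only [Sigma.mk.injEq, heq_eq_eq, Prod.mk.injEq, Subtype.mk.injEq, true_and] using h'

/-! ### The embedding of the graph generated by an occurrence -/

/-- The graph generated from a hyperarc sits in the graph generated from another one, at each of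
its occurrences. -/
noncomputable def Occ.emb {A B : N} (X : G.Occ A B) : G.Vertex B → G.Vertex A
  | .inl j => X.place (G.inp B j)
  | .inr ⟨C, Y, v⟩ => .inr ⟨C, X.append Y, v⟩

theorem Vertex.exists_place {A : N} (y : G.Vertex A) :
    (∃ j, y = Vertex.input j) ∨ ∃ (C : N) (Y : G.Occ A C) (v : G.V C), v ∉ Set.range (G.inp C) ∧
      Y.place v = y := by
  rcases y with j | ⟨C, Y, v, hv⟩
  · exact Or.inl ⟨j, rfl⟩
  · exact Or.inr ⟨C, Y, v, hv, Y.place_of_notMem hv⟩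

theorem Vertex.exists_place_of_lev {A : N} {y : G.Vertex A} (h : 1 ≤ y.lev) :
    ∃ (C : N) (Y : G.Occ A C) (v : G.V C), v ∉ Set.range (G.inp C) ∧ Y.place v = y := by
  rcases y.exists_place with ⟨j, rfl⟩ | h'
  · exact absurd h (by simp [Vertex.lev_input])
  · exact h'

theorem Occ.lev_place {A B : N} (X : G.Occ A B) {v : G.V B} (hv : v ∉ Set.range (G.inp B)) :
    (X.place v).lev = X.depth + 1 := by
  rw [X.place_of_notMem hv]; rfl

theorem Occ.emb_place {A B C : N} (X : G.Occ A B) (Y : G.Occ B C) (u : G.V C) :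
    X.emb (Y.place u) = (X.append Y).place u := by
  have h : ∀ {C} (Y : G.Occ B C) u, u ∉ Set.range (G.inp C) →
      X.emb (Y.place u) = (X.append Y).place u := by
    intro C Y u hu
    rw [Y.place_of_notMem hu, Occ.place_of_notMem _ hu]
    rfl
  induction Y with
  | root =>
    by_cases hu : u ∈ Set.range (G.inp B)
    · obtain ⟨j, rfl⟩ := hu
      rw [Occ.place_root_inp]
      rfl
    · exact h _ _ hu
  | child Y e ih =>
    by_cases hu : u ∈ Set.range (G.inp e.lab)
    · obtain ⟨j, rfl⟩ := hu
      rw [Occ.place_child_inp, ih, Occ.append, Occ.place_child_inp]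
    · exact h _ _ hu

theorem Occ.emb_root {A : N} (y : G.Vertex A) : (Occ.root : G.Occ A A).emb y = y := by
  rcases y.exists_place with ⟨j, rfl⟩ | ⟨C, Y, v, _, rfl⟩
  · exact Occ.place_root_inp j
  · rw [Occ.emb_place, Occ.root_append]

theorem IsOutside.lt_lev_emb_iff (hG : G.IsOutside) {A B : N} (X : G.Occ A B) (y : G.Vertex B) :
    X.depth + 1 ≤ (X.emb y).lev ↔ 1 ≤ y.lev := by
  rcases y.exists_place with ⟨j, rfl⟩ | ⟨C, Y, v, hv, rfl⟩
  · have : (X.emb (Vertex.input j)).lev ≤ X.depth := hG.lev_place_inp_le X j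
    rw [Vertex.lev_input]
    lia
  · rw [Occ.emb_place, Occ.lev_place _ hv, Occ.lev_place _ hv, Occ.depth_append]
    lia

theorem IsOutside.emb_injective (hG : G.IsOutside) {A B : N} (X : G.Occ A B) :
    Function.Injective X.emb := by
  intro y z h
  have hlev : 1 ≤ y.lev ↔ 1 ≤ z.lev := by
    rw [← hG.lt_lev_emb_iff X, ← hG.lt_lev_emb_iff X, h]
  rcases y with j | ⟨C, Y, v, hv⟩ <;> rcases z with j' | ⟨C', Y', v', hv'⟩
  · have := (G.inp B).injective (hG.place_injective X h)
    rw [this]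
  · simp [Vertex.lev] at hlev
  · simp [Vertex.lev] at hlev
  · have h' := Sum.inr.inj h
    have hX : (⟨C, X.append Y⟩ : Σ C, G.Occ A C) = ⟨C', X.append Y'⟩ :=
      congrArg (fun p : Σ B : N, G.Occ A B × {v : G.V B // v ∉ Set.range (G.inp B)} =>
        (⟨p.1, p.2.1⟩ : Σ C, G.Occ A C)) h'
    have hc := Occ.code_eq_of_sigma_eq hX
    rw [Occ.code_append, Occ.code_append] at hc
    -- Codes list the last hyperarc first, so the common initial occurrence `X` is a common suffix.
    cases Occ.sigma_eq_of_code_eq Y Y' (List.append_cancel_right hc)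
    simp only [Sigma.mk.injEq, heq_eq_eq, Prod.mk.injEq, true_and] at h'
    rw [h']

/-- A vertex created in the generated subgraph lies only on copies that belong to it. -/
theorem IsOutside.exists_append_of_place_eq (hG : G.IsOutside) {A B C : N} (X : G.Occ A B)
    {y : G.Vertex B} (hy : 1 ≤ y.lev) (Y' : G.Occ A C) (u : G.V C) (h : Y'.place u = X.emb y) :
    ∃ Y : G.Occ B C, X.append Y = Y' ∧ Y.place u = y := by
  obtain ⟨D, Y, v, hv, rfl⟩ := Vertex.exists_place_of_lev hy
  rw [Occ.emb_place] at h
  refine hG.place_cases (motive := fun C Y' u => ∃ Y₁ : G.Occ B C, X.append Y₁ = Y' ∧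
    Y₁.place u = Y.place v) hv ⟨Y, rfl, rfl⟩ (fun e l he => ⟨Y.child e, rfl, ?_⟩) Y' u h
  rw [Occ.place_child_inp, he]

/-- The vertices of `R^n[A]`, other than the inputs, that lie on no hyperarc left to rewrite. -/
def Complete {A : N} (n : ℕ∞) (y : G.Vertex A) : Prop :=
  1 ≤ y.lev ∧ ∀ (B : N) (Y : G.Occ A B) (u : G.V B), Y.place u = y → (Y.depth : ℕ∞) < n

theorem complete_top {A : N} {y : G.Vertex A} : Complete ⊤ y ↔ 1 ≤ y.lev :=
  ⟨fun h => h.1, fun h => ⟨h, fun _ _ _ _ => ENat.natCast_lt_top _⟩⟩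

/-- Every copy through `X.emb y` lies below `X`, and completeness of `y` puts it at depth less than
`n`. Hence embedding into the infinite graph creates no new outgoing arc at `y`. -/
theorem IsOutside.emb_mem_arc_iff (hG : G.IsOutside) {A B : N} (X : G.Occ A B) {n : ℕ∞}
    {y : G.Vertex B} (hy : Complete n y) (a : T₂) (t' : G.Vertex A) :
    (a, X.emb y, t') ∈ (G.rewr ⊤ A).arc ↔ ∃ t, X.emb t = t' ∧ (a, y, t) ∈ (G.rewr n B).arc := by
  constructor
  · rintro ⟨C, Y', -, u, w, ha, h1, h2⟩
    obtain ⟨Y, rfl, rfl⟩ := hG.exists_append_of_place_eq X hy.1 Y' u h1.symm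
    exact ⟨Y.place w, (X.emb_place Y w).trans h2.symm, C, Y, hy.2 C Y u rfl, u, w, ha, rfl, rfl⟩
  · rintro ⟨t, rfl, C, Y, -, u, w, ha, h1, h2⟩
    refine ⟨C, X.append Y, ENat.natCast_lt_top _, u, w, ha, ?_, ?_⟩
    · rw [← Occ.emb_place]; exact congrArg X.emb h1
    · rw [← Occ.emb_place]; exact congrArg X.emb h2

theorem IsOutside.emb_mem_colour_iff (hG : G.IsOutside) {A B : N} (X : G.Occ A B) {n : ℕ∞}
    {y : G.Vertex B} (hy : Complete n y) (c : T₁) :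
    X.emb y ∈ (G.rewr ⊤ A).colour c ↔ y ∈ (G.rewr n B).colour c := by
  constructor
  · rintro ⟨C, Y', -, u, hc, h1⟩
    obtain ⟨Y, rfl, rfl⟩ := hG.exists_append_of_place_eq X hy.1 Y' u h1.symm
    exact ⟨C, Y, hy.2 C Y u rfl, u, hc, rfl⟩
  · rintro ⟨C, Y, -, u, hc, h1⟩
    refine ⟨C, X.append Y, ENat.natCast_lt_top _, u, hc, ?_⟩
    rw [← Occ.emb_place]; exact congrArg X.emb h1

/-! ### Transfer of transition weights. -/

section weights
variable [Fintype T₂] {μ : T₂ → Set.Icc (0 : ℝ) 1}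

theorem IsOutside.tsum_weight_emb (hG : G.IsOutside) {A B : N} (X : G.Occ A B) {n : ℕ∞}
    {y : G.Vertex B} (hy : Complete n y) (f : G.Vertex A → ℝ≥0∞) :
    ∑' t, (G.rewr ⊤ A).weight μ (X.emb y) t * f t =
      ∑' t, (G.rewr n B).weight μ y t * f (X.emb t) :=
  ColHypergraph.tsum_weight_map μ (hG.emb_injective X) (hG.emb_mem_arc_iff X hy) f

theorem IsProbabilistic.tsum_weight_le_one (hμ : G.IsProbabilistic μ) (s : G.Vertex G.start) :
    ∑' t, (G.rewr ⊤ G.start).weight μ s t ≤ 1 := by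
  rw [ColHypergraph.tsum_weight]
  by_cases hs : s ∈ (G.rewr ⊤ G.start).terminalVerts
  · exact (hμ s hs).le
  · refine le_of_eq_of_le (Finset.sum_eq_zero fun a _ => ?_) zero_le_one
    have : ({t | (a, s, t) ∈ (G.rewr ⊤ G.start).arc} : Set _) = ∅ :=
      Set.eq_empty_of_forall_notMem fun t ht => hs (Or.inr (Or.inl ⟨a, t, ht⟩))
    simp [this]

/-- A finite portion embeds injectively and arc by arc into the generated graph, so its row sums can
only be smaller, even where arcs are still missing. -/
theorem IsProbabilistic.tsum_weight_rewr_le_one (hμ : G.IsProbabilistic μ) (hG : G.IsOutside)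
    {A : N} (X : G.Occ G.start A) (n : ℕ∞) (s : G.Vertex A) :
    ∑' t, (G.rewr n A).weight μ s t ≤ 1 := by
  refine (ColHypergraph.tsum_weight_le μ (hG.emb_injective X) ?_ s).trans
    (hμ.tsum_weight_le_one (X.emb s))
  rintro a s t ⟨C, Y, -, u, w, ha, h1, h2⟩
  refine ⟨C, X.append Y, ENat.natCast_lt_top _, u, w, ha, ?_, ?_⟩
  · rw [← Occ.emb_place]; exact congrArg X.emb h1
  · rw [← Occ.emb_place]; exact congrArg X.emb h2

end weights

end HRGrammar

namespace HRGrammar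

variable {N T₁ T₂ : Type*} {G : HRGrammar N T₁ T₂}

/-! ### Ports and local regions -/

theorem place_inp_mem_ports {A B : N} (X : G.Occ A B) {n : ℕ} (h : X.depth ≤ n)
    (j : Fin (G.ar B)) : X.place (G.inp B j) ∈ G.ports n A :=
  ⟨X.depth, h, ⟨B, fun i => X.place (G.inp B i)⟩, ⟨B, X, rfl, rfl⟩, j, rfl⟩

theorem place_att_mem_ports {A B : N} (X : G.Occ A B) {n : ℕ} (h : X.depth + 1 ≤ n)
    (e : G.Arc B) (i : Fin (G.ar e.lab)) : X.place (e.att i) ∈ G.ports n A := by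
  rw [← Occ.place_child_inp]
  exact place_inp_mem_ports (X.child e) h i

theorem exists_of_mem_ports {A : N} {n : ℕ} {y : G.Vertex A} (h : y ∈ G.ports n A) :
    ∃ (B : N) (X : G.Occ A B) (j : Fin (G.ar B)), X.place (G.inp B j) = y := by
  obtain ⟨m, _, Y, ⟨B, X, _, rfl⟩, i, rfl⟩ := h
  exact ⟨B, X, i, rfl⟩

/-- The vertices lying on the copies of right-hand sides at the occurrences in `O`. -/
def region {A : N} (O : Set (Σ B, G.Occ A B)) : Set (G.Vertex A) :=
  {y | ∃ p ∈ O, ∃ u, p.2.place u = y}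

/-- Copies are glued only along ports: a vertex shared by two copies is an output of one and an
input of the other. A non-port of the region therefore lies on no copy outside `O`. -/
theorem IsOutside.of_mem_region (hG : G.IsOutside) {A : N} {O : Set (Σ B, G.Occ A B)} {n : ℕ}
    (hO : ∀ p ∈ O, p.2.depth + 1 ≤ n) {y : G.Vertex A} (hy : y ∈ region O)
    (hP : y ∉ G.ports n A) :
    1 ≤ y.lev ∧ ∀ (B : N) (Y : G.Occ A B) (u : G.V B), Y.place u = y →
      (⟨B, Y⟩ : Σ B, G.Occ A B) ∈ O := by
  obtain ⟨⟨C, X⟩, hp, v, rfl⟩ := hy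
  have hv : v ∉ Set.range (G.inp C) := by
    rintro ⟨j, rfl⟩
    exact hP (place_inp_mem_ports X ((Nat.le_succ _).trans (hO _ hp)) j)
  refine ⟨by rw [Occ.lev_place _ hv]; lia, fun B Y u h => ?_⟩
  refine hG.place_cases (motive := fun B Y _ => (⟨B, Y⟩ : Σ B, G.Occ A B) ∈ O) hv hp
    (fun e l he => absurd ?_ hP) Y u h
  rw [← he]
  exact place_att_mem_ports X (hO _ hp) e l

theorem IsOutside.of_mem_region_of_mem_ports (hG : G.IsOutside) {A : N}
    {O : Set (Σ B, G.Occ A B)} {n : ℕ} {y : G.Vertex A} (hy : y ∈ region O)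
    (hP : y ∈ G.ports n A) :
    ∃ p ∈ O, (∃ j, p.2.place (G.inp p.1 j) = y) ∨
      ∃ (e : G.Arc p.1) (i : Fin (G.ar e.lab)), p.2.place (e.att i) = y := by
  obtain ⟨⟨C, X⟩, hp, v, rfl⟩ := hy
  refine ⟨⟨C, X⟩, hp, ?_⟩
  by_cases hv : v ∈ Set.range (G.inp C)
  · obtain ⟨j, rfl⟩ := hv
    exact Or.inl ⟨j, rfl⟩
  · obtain ⟨B, Y, j, h⟩ := exists_of_mem_ports hP
    right
    refine hG.place_cases (motive := fun B Y u => u ∈ Set.range (G.inp B) →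
      ∃ (e : G.Arc C) (i : Fin (G.ar e.lab)), X.place (e.att i) = X.place v) hv
      (fun h => absurd h hv) (fun e l he _ => ⟨e, l, by rw [he]⟩) Y _ h ⟨j, rfl⟩

/-- The indicator function of an input. -/
noncomputable def hitInput {A : N} (j : Fin (G.ar A)) : G.Vertex A → ℝ≥0∞ :=
  ({Vertex.input j} : Set (G.Vertex A)).indicator 1

theorem hitInput_self {A : N} (j : Fin (G.ar A)) : hitInput j (Vertex.input j) = 1 := by
  simp [hitInput]

theorem hitInput_of_ne {A : N} {j : Fin (G.ar A)} {y : G.Vertex A} (h : y ≠ Vertex.input j) :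
    hitInput j y = 0 :=
  Set.indicator_of_notMem (s := {Vertex.input j}) h 1

theorem hitInput_of_lev {A : N} (j : Fin (G.ar A)) {y : G.Vertex A} (h : 1 ≤ y.lev) :
    hitInput j y = 0 :=
  hitInput_of_ne (by rintro rfl; exact Nat.not_succ_le_zero 0 h)

/-! ### Safe and goal vertices, and the ports near a hyperarc. -/

section chains
variable (μ : T₂ → Set.Icc (0 : ℝ) 1) (c₁ c₂ : T₁)

/-- The vertices of `V₁ \ V₂` that are not inputs. -/
def safe (A : N) : Set (G.Vertex A) :=
  ((G.rewr ⊤ A).colour c₁ \ (G.rewr ⊤ A).colour c₂) ∩ {y | 1 ≤ y.lev}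

/-- The vertices of `V₂` that are not inputs. -/
def goal (A : N) : Set (G.Vertex A) := (G.rewr ⊤ A).colour c₂ ∩ {y | 1 ≤ y.lev}

variable {c₁ c₂}

theorem emb_mem_colour_top_iff (hG : G.IsOutside) {A B : N} (X : G.Occ A B) {y : G.Vertex B}
    (hy : 1 ≤ y.lev) (c : T₁) :
    X.emb y ∈ (G.rewr ⊤ A).colour c ↔ y ∈ (G.rewr ⊤ B).colour c :=
  hG.emb_mem_colour_iff X (complete_top.2 hy) c

theorem emb_mem_goal_iff (hG : G.IsOutside) {A B : N} (X : G.Occ A B) {y : G.Vertex B}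
    (hy : 1 ≤ y.lev) : X.emb y ∈ goal c₂ A ↔ y ∈ goal c₂ B := by
  have := (hG.lt_lev_emb_iff X y).2 hy
  have h : 1 ≤ (X.emb y).lev := by lia
  simp only [goal, Set.mem_inter_iff, emb_mem_colour_top_iff hG X hy, Set.mem_ofPred_eq, hy, h]

theorem emb_mem_safe_iff (hG : G.IsOutside) {A B : N} (X : G.Occ A B) {y : G.Vertex B}
    (hy : 1 ≤ y.lev) : X.emb y ∈ safe c₁ c₂ A ↔ y ∈ safe c₁ c₂ B := by
  have := (hG.lt_lev_emb_iff X y).2 hy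
  have h : 1 ≤ (X.emb y).lev := by lia
  simp only [safe, Set.mem_inter_iff, Set.mem_sdiff, emb_mem_colour_top_iff hG X hy,
    Set.mem_ofPred_eq, hy, h]

theorem lev_place_att (hG : G.IsOutside) {A B : N} (X : G.Occ A B) (e : G.Arc B)
    (i : Fin (G.ar e.lab)) : (X.place (e.att i)).lev = X.depth + 1 :=
  X.lev_place (hG.att_notMem e i)

theorem emb_vB {A B : N} (X : G.Occ A B) (e : G.Arc B) (i : Fin (G.ar e.lab)) :
    X.emb (vB e i) = X.place (e.att i) := X.emb_place .root _

theorem one_le_lev_vB (hG : G.IsOutside) {A : N} (e : G.Arc A) (i : Fin (G.ar e.lab)) :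
    1 ≤ (vB e i).lev := (lev_place_att hG .root e i).ge

theorem mem_colour_iff_of_complete (hG : G.IsOutside) {A : N} {n : ℕ∞} {y : G.Vertex A}
    (hy : Complete n y) (c : T₁) : y ∈ (G.rewr ⊤ A).colour c ↔ y ∈ (G.rewr n A).colour c := by
  rw [← hG.emb_mem_colour_iff .root hy c, Occ.emb_root]

theorem mem_safe_iff_of_complete (hG : G.IsOutside) {A : N} {n : ℕ∞} {y : G.Vertex A}
    (hy : Complete n y) :
    y ∈ safe c₁ c₂ A ↔ y ∈ (G.rewr n A).colour c₁ \ (G.rewr n A).colour c₂ := by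
  simp only [safe, Set.mem_inter_iff, Set.mem_sdiff, mem_colour_iff_of_complete hG hy,
    Set.mem_ofPred_eq, hy.1, and_true]

theorem mem_region_of_arc {A : N} {O : Set (Σ B, G.Occ A B)} {n : ℕ∞} {y t : G.Vertex A}
    (hy : ∀ (B : N) (Y : G.Occ A B) (u : G.V B), Y.place u = y →
      (⟨B, Y⟩ : Σ B, G.Occ A B) ∈ O) {a : T₂} (h : (a, y, t) ∈ (G.rewr n A).arc) :
    t ∈ region O := by
  obtain ⟨B, Y, -, u, w, -, h1, h2⟩ := h
  exact ⟨⟨B, Y⟩, hy B Y u h1.symm, w, h2.symm⟩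

/-- The occurrences in `R²[A]` met by paths that start on the hyperarc `e` of the right-hand side
of `A` and visit no other port. -/
def near {A : N} (e : G.Arc A) : Set (Σ B, G.Occ A B) :=
  {⟨A, .root⟩, ⟨e.lab, Occ.root.child e⟩}

theorem depth_of_mem_near {A : N} {e : G.Arc A} {p : Σ B, G.Occ A B} (hp : p ∈ near e) :
    p.2.depth + 1 ≤ 2 := by
  rcases hp with rfl | rfl <;> simp [Occ.depth]

theorem near_of_place_eq_vB (hG : G.IsOutside) {A : N} (e : G.Arc A) (i : Fin (G.ar e.lab))
    (B : N) (Y : G.Occ A B) (u : G.V B) (h : Y.place u = vB e i) :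
    (⟨B, Y⟩ : Σ B, G.Occ A B) ∈ near e := by
  refine hG.place_cases (motive := fun B Y _ => (⟨B, Y⟩ : Σ B, G.Occ A B) ∈ near e)
    (hG.att_notMem e i) (Or.inl rfl) (fun e' l h' => ?_) Y u h
  cases hG.att_inj h'
  exact Or.inr rfl

/-- This is why two rewritings are needed: the arcs at `(B,i)_A` come from the copy of the rule of
`A` and from the one replacing its hyperarc, and from no other, since each output lies on a single
hyperarc. -/
theorem complete_two_vB (hG : G.IsOutside) {A : N} (e : G.Arc A) (i : Fin (G.ar e.lab)) :
    Complete 2 (vB e i) :=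
  ⟨one_le_lev_vB hG e i, fun B Y u h => by
    exact_mod_cast depth_of_mem_near (near_of_place_eq_vB hG e i B Y u h)⟩

/-- The ports of `R²[A]` near the hyperarc `e`. -/
noncomputable def nearPort {A : N} (e : G.Arc A) :
    Fin (G.ar A) ⊕ (Σ d : G.Arc A, Fin (G.ar d.lab)) ⊕ (Σ c : G.Arc e.lab, Fin (G.ar c.lab)) →
      G.Vertex A
  | .inl j => G.vA A j
  | .inr (.inl ⟨d, h⟩) => vB d h
  | .inr (.inr ⟨c, k⟩) => vC e c k

/-- The three families have levels `0`, `1` and `2`; within each, `IsOutside` separates the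
positions. -/
theorem nearPort_injective (hG : G.IsOutside) {A : N} (e : G.Arc A) :
    Function.Injective (nearPort e) := by
  have hA : ∀ j, (G.vA A j).lev = 0 := fun j => by rw [vA, Occ.place_root_inp]; rfl
  have hB : ∀ (d : G.Arc A) h, (vB d h).lev = 1 := fun d h => lev_place_att hG .root d h
  have hC : ∀ (c : G.Arc e.lab) k, (vC e c k).lev = 2 := fun c k => lev_place_att hG _ c k
  rintro (j | ⟨d, h⟩ | ⟨c, k⟩) (j' | ⟨d', h'⟩ | ⟨c', k'⟩) hyp <;>
    have hlev := congrArg Vertex.lev hyp <;>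
    simp only [nearPort, hA, hB, hC] at hlev hyp <;> try lia
  · rw [(G.inp A).injective (hG.place_injective _ hyp)]
  · rw [hG.att_inj (hG.place_injective _ hyp)]
  · rw [hG.att_inj (hG.place_injective _ hyp)]

theorem nearPort_mem_ports {A : N} (e : G.Arc A) (k) : nearPort e k ∈ G.ports 2 A := by
  rcases k with j | ⟨d, h⟩ | ⟨c, k⟩
  · exact place_inp_mem_ports _ (by simp [Occ.depth]) j
  · exact place_att_mem_ports _ (by simp [Occ.depth]) d h
  · exact place_att_mem_ports _ (by simp [Occ.depth]) c k

theorem mem_range_nearPort (hG : G.IsOutside) {A : N} (e : G.Arc A) (y : G.Vertex A)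
    (hy : y ∈ region (near e)) (hP : y ∈ G.ports 2 A) : y ∈ Set.range (nearPort e) := by
  obtain ⟨p, hp | hp, h⟩ := hG.of_mem_region_of_mem_ports hy hP
  · subst hp
    rcases h with ⟨j, rfl⟩ | ⟨d, h, rfl⟩
    · exact ⟨.inl j, rfl⟩
    · exact ⟨.inr (.inl ⟨d, h⟩), rfl⟩
  · cases hp
    rcases h with ⟨j, rfl⟩ | ⟨c, k, rfl⟩
    -- The inputs of the copy replacing `e` are the positions of `e` itself, already counted among
    -- the `D_h`.
    · exact ⟨.inr (.inl ⟨e, j⟩), (Occ.place_child_inp .root e j).symm⟩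
    · exact ⟨.inr (.inr ⟨c, k⟩), rfl⟩

/-! ### Rewards in the generated graphs -/

variable [Fintype T₂]
variable (c₁ c₂)

/-- Rewards in the graph generated from `A`, up to time `n`, before leaving `V₁ \ V₂` or reaching
an input. -/
noncomputable def rew (n : ℕ∞) {A : N} (g : G.Vertex A → ℝ≥0∞) : G.Vertex A → ℝ≥0∞ :=
  reward ((G.rewr ⊤ A).weight μ) n (safe c₁ c₂ A) g

/-- The probability to reach the input `j` before time `n`. -/
noncomputable def dec (n : ℕ∞) {A : N} (y : G.Vertex A) (j : Fin (G.ar A)) : ℝ≥0∞ :=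
  rew μ c₁ c₂ n (hitInput j) y

/-- The probability to reach `V₂` before time `n`. -/
noncomputable def win (n : ℕ∞) {A : N} (y : G.Vertex A) : ℝ≥0∞ :=
  rew μ c₁ c₂ n ((goal c₂ A).indicator 1) y

variable {μ c₁ c₂}

/-- Rewards are transferred along the embedding of a generated subgraph. -/
theorem reward_emb (hG : G.IsOutside) {A B : N} (X : G.Occ A B) {K : Set (G.Vertex A)}
    {g : G.Vertex A → ℝ≥0∞} {g' : G.Vertex B → ℝ≥0∞}
    (hK : ∀ y, X.emb y ∈ K ↔ y ∈ safe c₁ c₂ B) (hg : ∀ y, g (X.emb y) = g' y) (n : ℕ∞)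
    (y : G.Vertex B) :
    reward ((G.rewr ⊤ A).weight μ) n K g (X.emb y) = rew μ c₁ c₂ n g' y :=
  reward_transfer X.emb Set.univ (fun y _ => hK y) (fun y _ => hg y)
    (fun _ _ hy f => hG.tsum_weight_emb X (complete_top.2 hy.2) f) (fun _ _ _ _ _ => trivial) n
    (Set.mem_univ y)

/-- The level of `v'` is `X.depth + 1`, so `Lev ≥ Lev v'` pulls back along `X.emb` to "not an
input". The right-hand side no longer mentions `X`, which is the independence claim. -/
theorem ofReal_decAt (hG : G.IsOutside) (hμ : G.IsProbabilistic μ) {A : N}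
    (X : G.Occ G.start A) (e : G.Arc A) (i : Fin (G.ar e.lab)) (j : Fin (G.ar A)) :
    ENNReal.ofReal (decAt μ c₁ c₂ X e i j) = dec μ c₁ c₂ ⊤ (vB e i) j := by
  rw [decAt, ofReal_probUntil hμ.tsum_weight_le_one, ← emb_vB, dec]
  refine reward_emb hG X (fun y => ?_) (fun y => ?_) ⊤ _
  · rw [emb_vB, lev_place_att hG]
    by_cases hy : 1 ≤ y.lev
    · have h := (hG.lt_lev_emb_iff X y).2 hy
      -- The target has level at most `X.depth`, so removing it from the admissible set changes
      -- nothing there.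
      have h' : X.emb y ≠ X.place (G.inp A j) := fun h' => by
        have := hG.lev_place_inp_le X j
        rw [← h'] at this
        lia
      simp only [safe, Set.mem_inter_iff, Set.mem_sdiff, emb_mem_colour_top_iff hG X hy,
        Set.mem_ofPred_eq, hy, h, h', Set.mem_singleton_iff, not_false_eq_true, and_true]
    · have h := mt (hG.lt_lev_emb_iff X y).1 hy
      simp only [safe, Set.mem_inter_iff, Set.mem_sdiff, Set.mem_ofPred_eq, hy, h, and_false,
        false_and]
  · refine Set.indicator_eq_indicator ?_ rfl
    exact (hG.emb_injective X).eq_iff (b := Vertex.input j)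

theorem ofReal_winAt (hG : G.IsOutside) (hμ : G.IsProbabilistic μ) {A : N}
    (X : G.Occ G.start A) (e : G.Arc A) (i : Fin (G.ar e.lab)) :
    ENNReal.ofReal (winAt μ c₁ c₂ X e i) = win μ c₁ c₂ ⊤ (vB e i) := by
  rw [winAt, ofReal_probUntil hμ.tsum_weight_le_one, ← emb_vB, win]
  refine reward_emb hG X (fun y => ?_) (fun y => ?_) ⊤ _
  · rw [emb_vB, lev_place_att hG]
    by_cases hy : 1 ≤ y.lev
    · have h := (hG.lt_lev_emb_iff X y).2 hy
      simp only [safe, Set.mem_inter_iff, Set.mem_sdiff, emb_mem_colour_top_iff hG X hy,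
        Set.mem_ofPred_eq, hy, h, and_true]
    · have h := mt (hG.lt_lev_emb_iff X y).1 hy
      simp only [safe, Set.mem_inter_iff, Set.mem_sdiff, Set.mem_ofPred_eq, hy, h, and_false,
        false_and]
  · refine Set.indicator_eq_indicator ?_ rfl
    rw [emb_vB, lev_place_att hG]
    by_cases hy : 1 ≤ y.lev
    · have h := (hG.lt_lev_emb_iff X y).2 hy
      simp only [goal, Set.mem_inter_iff, emb_mem_colour_top_iff hG X hy,
        Set.mem_ofPred_eq, hy, h, and_true]
    · have h := mt (hG.lt_lev_emb_iff X y).1 hy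
      simp only [goal, Set.mem_inter_iff, Set.mem_ofPred_eq, hy, h, and_false]

/-! ### Expansion of stopped rewards over the ports of a local region -/

theorem tsum_weight_of_complete (hG : G.IsOutside) {A : N} {n : ℕ∞} {y : G.Vertex A}
    (hy : Complete n y) (f : G.Vertex A → ℝ≥0∞) :
    ∑' t, (G.rewr ⊤ A).weight μ y t * f t = ∑' t, (G.rewr n A).weight μ y t * f t := by
  have h := hG.tsum_weight_emb (μ := μ) .root hy f
  simpa only [Occ.emb_root] using h

/-- Stopped at the ports, a walk cannot leave the region, and off the ports `R^n[A]` and the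
infinite graph have there the same outgoing arcs and colours. Linearity then splits the reward into
the part `gn` earned off the ports and one hitting probability per port. -/
theorem reward_stopAt_ports (hG : G.IsOutside) {A : N} {O : Set (Σ B, G.Occ A B)} {n : ℕ}
    (hO : ∀ p ∈ O, p.2.depth + 1 ≤ n) {ι : Type*} {q : ι → G.Vertex A}
    (hq : Function.Injective q) (hqP : ∀ k, q k ∈ G.ports n A)
    (hqO : ∀ y ∈ region O, y ∈ G.ports n A → y ∈ Set.range q)
    {g gn : G.Vertex A → ℝ≥0∞} (hg : ∀ y ∈ region O, y ∉ G.ports n A → g y = gn y)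
    (hgn : ∀ y ∈ G.ports n A, gn y = 0) (f : G.Vertex A → ℝ≥0∞) (m : ℕ∞) {y : G.Vertex A}
    (hy : y ∈ region O) :
    reward ((G.rewr ⊤ A).weight μ) m (safe c₁ c₂ A \ G.ports n A) (stopAt (G.ports n A) g f) y =
      reward ((G.rewr n A).weight μ) m
        (((G.rewr n A).colour c₁ \ (G.rewr n A).colour c₂) \ G.ports n A) gn y +
      ∑' k, f (q k) * reward ((G.rewr n A).weight μ) m
        (((G.rewr n A).colour c₁ \ (G.rewr n A).colour c₂) \ G.ports n A)
        (({q k} : Set (G.Vertex A)).indicator 1) y := by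
  have hcomp : ∀ y ∈ region O, y ∉ G.ports n A → Complete n y := fun y hy hP => by
    have h := hG.of_mem_region hO hy hP
    refine ⟨h.1, fun B Y u hu => ?_⟩
    exact_mod_cast hO _ (h.2 B Y u hu)
  rw [← reward_linear]
  -- All stages of rewriting share one vertex type, so the transfer map is the identity.
  refine reward_transfer (φ := id) (region O) (fun y hy => ?_) (fun y hy => ?_)
    (fun y hy hyK f => ?_) (fun y hy hyK t ht => ?_) m hy
  · by_cases hP : y ∈ G.ports n A
    · simp [hP]
    · simp only [id, Set.mem_sdiff (s := safe c₁ c₂ A), mem_safe_iff_of_complete hG (hcomp y hy hP)]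
      rfl
  · rw [← indicator_range_eq_tsum hq]
    by_cases hP : y ∈ G.ports n A
    · rw [id, stopAt_of_mem _ _ hP, hgn y hP, Set.indicator_of_mem (hqO y hy hP), zero_add]
    · have : y ∉ Set.range q := by
        rintro ⟨k, rfl⟩
        exact hP (hqP k)
      rw [id, stopAt_of_notMem _ _ hP, hg y hy hP, Set.indicator_of_notMem this, add_zero]
  · exact tsum_weight_of_complete hG (hcomp y hy hyK.2) f
  · obtain ⟨a, ha⟩ := ColHypergraph.exists_arc_of_weight_ne_zero μ ht
    exact mem_region_of_arc (hG.of_mem_region hO hy hyK.2).2 ha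

variable [Finite N]

/-- Expansion of a reward stopped at the ports of `R²[A]`, from a vertex of the hyperarc `e`. -/
theorem killedStep_reward_stopAt (hG : G.IsOutside) {A : N}
    (hw : ∀ s, ∑' t, (G.rewr 2 A).weight μ s t ≤ 1) (e : G.Arc A) (i : Fin (G.ar e.lab))
    {g gn : G.Vertex A → ℝ≥0∞} (hg : ∀ y ∈ region (near e), y ∉ G.ports 2 A → g y = gn y)
    (hgn : ∀ y ∈ G.ports 2 A, gn y = 0) (f : G.Vertex A → ℝ≥0∞) :
    killedStep ((G.rewr ⊤ A).weight μ) (safe c₁ c₂ A) (reward ((G.rewr ⊤ A).weight μ) ⊤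
        (safe c₁ c₂ A \ G.ports 2 A) (stopAt (G.ports 2 A) g f)) (vB e i) =
      killedStep ((G.rewr 2 A).weight μ) (G.locCol A c₁ \ G.locCol A c₂)
        (reward ((G.rewr 2 A).weight μ) ⊤ ((G.locCol A c₁ \ G.locCol A c₂) \ G.ports 2 A) gn)
        (vB e i) +
      (∑ j, ENNReal.ofReal (pLeft μ c₁ c₂ e i j) * f (Vertex.input j) +
        (∑ d : G.Arc A, ∑ h : Fin (G.ar d.lab),
          ENNReal.ofReal (pLevel μ c₁ c₂ e i d h) * f (vB d h) +
        ∑ c : G.Arc e.lab, ∑ k : Fin (G.ar c.lab),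
          ENNReal.ofReal (pRight μ c₁ c₂ e i c k) * f (vC e c k))) := by
  have hfirst : ∀ k, ENNReal.ofReal (pHit μ c₁ c₂ e i (nearPort e k)) * f (nearPort e k) =
      f (nearPort e k) * killedStep ((G.rewr 2 A).weight μ) (G.locCol A c₁ \ G.locCol A c₂)
        (reward ((G.rewr 2 A).weight μ) ⊤ ((G.locCol A c₁ \ G.locCol A c₂) \ G.ports 2 A)
          (({nearPort e k} : Set (G.Vertex A)).indicator 1)) (vB e i) := fun k => by
    rw [pHit, ofReal_probFirstHit hw _ _ _ (nearPort_mem_ports e k), mul_comm]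
  have hsum : ∑ j, ENNReal.ofReal (pLeft μ c₁ c₂ e i j) * f (Vertex.input j) +
        (∑ d : G.Arc A, ∑ h : Fin (G.ar d.lab),
          ENNReal.ofReal (pLevel μ c₁ c₂ e i d h) * f (vB d h) +
        ∑ c : G.Arc e.lab, ∑ k : Fin (G.ar c.lab),
          ENNReal.ofReal (pRight μ c₁ c₂ e i c k) * f (vC e c k)) =
      ∑' k, f (nearPort e k) * killedStep ((G.rewr 2 A).weight μ)
        (G.locCol A c₁ \ G.locCol A c₂)
        (reward ((G.rewr 2 A).weight μ) ⊤ ((G.locCol A c₁ \ G.locCol A c₂) \ G.ports 2 A)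
          (({nearPort e k} : Set (G.Vertex A)).indicator 1)) (vB e i) := by
    simp only [← hfirst]
    rw [tsum_fintype, Fintype.sum_sum_type, Fintype.sum_sum_type, Fintype.sum_sigma,
      Fintype.sum_sigma]
    congr 1
    refine Finset.sum_congr rfl fun j _ => ?_
    simp only [nearPort, pLeft]
    congr 2
    exact (Occ.place_root_inp j).symm
  rw [hsum, ← killedStep_linear]
  -- The start is itself a port, hence the first step is treated apart: completeness makes it the
  -- same in both graphs, and it ends in the region.
  have hcomp := complete_two_vB hG e i
  by_cases hs : vB e i ∈ safe c₁ c₂ A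
  · rw [killedStep, killedStep, Set.indicator_of_mem hs,
      Set.indicator_of_mem (show vB e i ∈ G.locCol A c₁ \ G.locCol A c₂ from
        (mem_safe_iff_of_complete hG hcomp).1 hs), tsum_weight_of_complete hG hcomp]
    refine tsum_congr fun t => ?_
    by_cases ht : (G.rewr 2 A).weight μ (vB e i) t = 0
    · simp [ht]
    · obtain ⟨a, ha⟩ := ColHypergraph.exists_arc_of_weight_ne_zero μ ht
      have htO := mem_region_of_arc (near_of_place_eq_vB hG e i) ha
      congr 1
      exact reward_stopAt_ports hG (fun p hp => depth_of_mem_near hp) (nearPort_injective hG e)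
        (nearPort_mem_ports e) (mem_range_nearPort hG e) hg hgn f ⊤ htO
  · rw [killedStep, killedStep, Set.indicator_of_notMem hs, Set.indicator_of_notMem
      (show vB e i ∉ G.locCol A c₁ \ G.locCol A c₂ from
        fun h => hs ((mem_safe_iff_of_complete hG hcomp).2 h))]



end chains

end HRGrammar

namespace HRGrammar

variable {N T₁ T₂ : Type*} {G : HRGrammar N T₁ T₂}

/-! ### The equations -/

section equations

variable {μ : T₂ → Set.Icc (0 : ℝ) 1} {c₁ c₂ : T₁}

theorem input_notMem_safe {A : N} (j : Fin (G.ar A)) :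
    Vertex.input j ∉ safe c₁ c₂ A := fun h =>
  Nat.not_succ_le_zero 0 h.2

theorem emb_child_input {A : N} (e : G.Arc A) (l : Fin (G.ar e.lab)) :
    ((Occ.root : G.Occ A A).child e).emb (Vertex.input l) = vB e l :=
  Occ.place_child_inp .root e l

theorem emb_child_vB {A : N} (e : G.Arc A) (c : G.Arc e.lab) (k : Fin (G.ar c.lab)) :
    ((Occ.root : G.Occ A A).child e).emb (vB c k) = vC e c k := emb_vB _ c k

/-- Outputs differ from inputs, so the graph generated by `e` contains no input of `A`. In the `Dec`
equation the excursion from `C_k` therefore earns nothing before returning to `e`. -/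
theorem hitInput_emb (hG : G.IsOutside) {A : N} (e : G.Arc A) (j : Fin (G.ar A))
    (y : G.Vertex e.lab) : hitInput j (((Occ.root : G.Occ A A).child e).emb y) = 0 := by
  refine hitInput_of_lev j ?_
  rcases y.exists_place with ⟨l, rfl⟩ | ⟨C, Y, v, hv, rfl⟩
  · rw [emb_child_input]
    exact one_le_lev_vB hG e l
  · rw [Occ.emb_place, Occ.lev_place _ hv]
    lia

theorem indicator_goal_input {A : N} (j : Fin (G.ar A)) :
    (goal c₂ A).indicator (1 : G.Vertex A → ℝ≥0∞) (Vertex.input j) = 0 :=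
  Set.indicator_of_notMem (fun h => Nat.not_succ_le_zero 0 h.2) _

theorem indicator_goal_emb (hG : G.IsOutside) {A B : N} (X : G.Occ A B) (y : G.Vertex B)
    (hy : 1 ≤ y.lev) : (goal c₂ A).indicator (1 : G.Vertex A → ℝ≥0∞) (X.emb y) =
      (goal c₂ B).indicator 1 y :=
  Set.indicator_eq_indicator (emb_mem_goal_iff hG X hy) rfl

variable [Fintype T₂]

/-- One step is taken before stopping, so that `P` is met at a positive time even when `s` is in
`P`. -/
theorem rew_top_eq {A : N} (P : Set (G.Vertex A)) (g : G.Vertex A → ℝ≥0∞) (s : G.Vertex A) :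
    rew μ c₁ c₂ ⊤ g s = g s + killedStep ((G.rewr ⊤ A).weight μ) (safe c₁ c₂ A)
      (reward ((G.rewr ⊤ A).weight μ) ⊤ (safe c₁ c₂ A \ P)
        (stopAt P g (rew μ c₁ c₂ ⊤ g))) s := by
  unfold rew
  rw [reward_stopped, ← reward_succ, top_add]

theorem rew_succ_le {A : N} (n : ℕ) (P : Set (G.Vertex A)) (g : G.Vertex A → ℝ≥0∞)
    (s : G.Vertex A) :
    rew μ c₁ c₂ (n + 1) g s ≤ g s + killedStep ((G.rewr ⊤ A).weight μ) (safe c₁ c₂ A)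
      (reward ((G.rewr ⊤ A).weight μ) ⊤ (safe c₁ c₂ A \ P)
        (stopAt P g (rew μ c₁ c₂ n g))) s := by
  unfold rew
  rw [reward_succ]
  exact add_le_add_right (killedStep_mono _
    ((reward_le_stopped n _ P g).trans (reward_mono_left le_top _ _)) s) _

theorem rew_top_input {A : N} (g : G.Vertex A → ℝ≥0∞) (j : Fin (G.ar A)) :
    rew μ c₁ c₂ ⊤ g (Vertex.input j) = g (Vertex.input j) := by
  have h := reward_of_notMem (w := (G.rewr ⊤ A).weight μ) ⊤ g
    (input_notMem_safe (c₁ := c₁) (c₂ := c₂) j)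
  rwa [top_add] at h

theorem rew_input_le (n : ℕ∞) {A : N} (g : G.Vertex A → ℝ≥0∞) (j : Fin (G.ar A)) :
    rew μ c₁ c₂ n g (Vertex.input j) ≤ g (Vertex.input j) :=
  reward_le_of_notMem n g (input_notMem_safe j)

/-- Rewards from the graph generated by the hyperarc `e`, when they are stopped on `e`. -/
theorem reward_stopAt_arc (hG : G.IsOutside) {A : N} (e : G.Arc A) {g : G.Vertex A → ℝ≥0∞}
    {gB : G.Vertex e.lab → ℝ≥0∞}
    (hg : ∀ y, 1 ≤ y.lev → g (((Occ.root : G.Occ A A).child e).emb y) = gB y)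
    (hgB : ∀ l, gB (Vertex.input l) = 0) (f : G.Vertex A → ℝ≥0∞) (m : ℕ∞) (c : G.Arc e.lab)
    (k : Fin (G.ar c.lab)) :
    reward ((G.rewr ⊤ A).weight μ) m (safe c₁ c₂ A \ Set.range (vB e))
        (stopAt (Set.range (vB e)) g f) (vC e c k) =
      rew μ c₁ c₂ m gB (vB c k) + ∑ l, dec μ c₁ c₂ m (vB c k) l * f (vB e l) := by
  set X := (Occ.root : G.Occ A A).child e
  -- Seen from the generated graph, the hyperarc `e` is its set of inputs: stopping on `e` is
  -- reaching an input.
  have hmem : ∀ y, X.emb y ∈ Set.range (vB e) ↔ ¬ 1 ≤ y.lev := by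
    intro y
    constructor
    · rintro ⟨l, hl⟩ h
      rw [← emb_child_input] at hl
      rw [← hG.emb_injective X hl] at h
      exact Nat.not_succ_le_zero 0 h
    · intro h
      rcases y.exists_place with ⟨l, rfl⟩ | ⟨C, Y, v, hv, rfl⟩
      · exact ⟨l, (emb_child_input e l).symm⟩
      · rw [Occ.lev_place _ hv] at h; lia
  rw [← emb_child_vB, reward_emb hG X (g' := fun y => gB y + ∑' l, f (vB e l) *
    (hitInput l) y) (fun y => ?_) (fun y => ?_)]
  · unfold rew
    rw [reward_linear, tsum_fintype]
    simp only [mul_comm (f _)]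
    rfl
  · by_cases hy : 1 ≤ y.lev
    · rw [Set.mem_sdiff, emb_mem_safe_iff hG X hy, hmem]
      simp [hy]
    · rw [Set.mem_sdiff, hmem]
      simp [hy, safe]
  · rw [tsum_fintype]
    by_cases hy : 1 ≤ y.lev
    · rw [stopAt_of_notMem _ _ (mt (hmem y).1 (not_not.2 hy)), hg y hy,
        Finset.sum_eq_zero, add_zero]
      intro l _
      rw [hitInput_of_lev l hy, mul_zero]
    · rw [stopAt_of_mem _ _ ((hmem y).2 hy)]
      rcases y.exists_place with ⟨l, rfl⟩ | ⟨C, Y, v, hv, rfl⟩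
      · rw [hgB, zero_add, Finset.sum_eq_single l, hitInput_self, mul_one, emb_child_input]
        · intro l' _ h
          rw [hitInput_of_ne fun h' => h (Vertex.input_injective h').symm, mul_zero]
        · simp
      · rw [Occ.lev_place _ hv] at hy; lia

theorem rew_top_vC (hG : G.IsOutside) {A : N} (e : G.Arc A) {g : G.Vertex A → ℝ≥0∞}
    {gB : G.Vertex e.lab → ℝ≥0∞}
    (hg : ∀ y, 1 ≤ y.lev → g (((Occ.root : G.Occ A A).child e).emb y) = gB y)
    (hgB : ∀ l, gB (Vertex.input l) = 0) (c : G.Arc e.lab) (k : Fin (G.ar c.lab)) :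
    rew μ c₁ c₂ ⊤ g (vC e c k) = rew μ c₁ c₂ ⊤ gB (vB c k) +
      ∑ l, dec μ c₁ c₂ ⊤ (vB c k) l * rew μ c₁ c₂ ⊤ g (vB e l) := by
  rw [← reward_stopAt_arc hG e hg hgB]
  exact (congrFun (reward_stopped _ _ g) _).symm

theorem rew_vC_le (hG : G.IsOutside) {A : N} (e : G.Arc A) {g : G.Vertex A → ℝ≥0∞}
    {gB : G.Vertex e.lab → ℝ≥0∞}
    (hg : ∀ y, 1 ≤ y.lev → g (((Occ.root : G.Occ A A).child e).emb y) = gB y)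
    (hgB : ∀ l, gB (Vertex.input l) = 0) (n : ℕ) (c : G.Arc e.lab) (k : Fin (G.ar c.lab)) :
    rew μ c₁ c₂ n g (vC e c k) ≤ rew μ c₁ c₂ n gB (vB c k) +
      ∑ l, dec μ c₁ c₂ n (vB c k) l * rew μ c₁ c₂ n g (vB e l) := by
  rw [← reward_stopAt_arc hG e hg hgB]
  exact reward_le_stopped n _ _ g _

variable [Finite N]

variable (μ c₁ c₂) in
/-- The right-hand side of the equation of `Dec(B_i, A_j)`. -/
noncomputable def decRhs {A : N} (e : G.Arc A) (i : Fin (G.ar e.lab)) (j : Fin (G.ar A))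
    (x : ∀ d : G.Arc A, Fin (G.ar d.lab) → ℝ≥0∞)
    (x' : ∀ c : G.Arc e.lab, Fin (G.ar c.lab) → Fin (G.ar e.lab) → ℝ≥0∞) : ℝ≥0∞ :=
  ENNReal.ofReal (pLeft μ c₁ c₂ e i j) +
    (∑ d : G.Arc A, ∑ h : Fin (G.ar d.lab), ENNReal.ofReal (pLevel μ c₁ c₂ e i d h) * x d h +
    ∑ c : G.Arc e.lab, ∑ k : Fin (G.ar c.lab), ENNReal.ofReal (pRight μ c₁ c₂ e i c k) *
      ∑ l, x' c k l * x e l)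

variable (μ c₁ c₂) in
/-- The right-hand side of the equation of `Win(B_i)_A`. -/
noncomputable def winRhs {A : N} (e : G.Arc A) (i : Fin (G.ar e.lab))
    (y : ∀ d : G.Arc A, Fin (G.ar d.lab) → ℝ≥0∞)
    (y' : ∀ c : G.Arc e.lab, Fin (G.ar c.lab) → ℝ≥0∞)
    (x' : ∀ c : G.Arc e.lab, Fin (G.ar c.lab) → Fin (G.ar e.lab) → ℝ≥0∞) : ℝ≥0∞ :=
  ENNReal.ofReal (pWin μ c₁ c₂ e i) +
    (∑ d : G.Arc A, ∑ h : Fin (G.ar d.lab), ENNReal.ofReal (pLevel μ c₁ c₂ e i d h) * y d h +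
    ∑ c : G.Arc e.lab, ∑ k : Fin (G.ar c.lab), ENNReal.ofReal (pRight μ c₁ c₂ e i c k) *
      (y' c k + ∑ l, x' c k l * y e l))

theorem decRhs_mono {A : N} (e : G.Arc A) (i : Fin (G.ar e.lab)) (j : Fin (G.ar A))
    {x₁ x₂ : ∀ d : G.Arc A, Fin (G.ar d.lab) → ℝ≥0∞}
    {x₁' x₂' : ∀ c : G.Arc e.lab, Fin (G.ar c.lab) → Fin (G.ar e.lab) → ℝ≥0∞}
    (h : ∀ d k, x₁ d k ≤ x₂ d k) (h' : ∀ c k l, x₁' c k l ≤ x₂' c k l) :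
    decRhs μ c₁ c₂ e i j x₁ x₁' ≤ decRhs μ c₁ c₂ e i j x₂ x₂' := by
  unfold decRhs
  gcongr with d _ k _ c _ k _ l _
  · exact h d k
  · exact h' c k l
  · exact h e l

theorem winRhs_mono {A : N} (e : G.Arc A) (i : Fin (G.ar e.lab))
    {y₁ y₂ : ∀ d : G.Arc A, Fin (G.ar d.lab) → ℝ≥0∞}
    {y₁' y₂' : ∀ c : G.Arc e.lab, Fin (G.ar c.lab) → ℝ≥0∞}
    {x₁' x₂' : ∀ c : G.Arc e.lab, Fin (G.ar c.lab) → Fin (G.ar e.lab) → ℝ≥0∞}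
    (h : ∀ d k, y₁ d k ≤ y₂ d k) (hy' : ∀ c k, y₁' c k ≤ y₂' c k)
    (h' : ∀ c k l, x₁' c k l ≤ x₂' c k l) :
    winRhs μ c₁ c₂ e i y₁ y₁' x₁' ≤ winRhs μ c₁ c₂ e i y₂ y₂' x₂' := by
  unfold winRhs
  gcongr with d _ k _ c _ k _ l _
  · exact h d k
  · exact hy' c k
  · exact h' c k l
  · exact h e l

/-- The target input is a port, so no reward is earned off the ports and the free term (`gn = 0`)
vanishes. -/
theorem dec_expansion (hG : G.IsOutside) {A : N}
    (hw : ∀ s, ∑' t, (G.rewr 2 A).weight μ s t ≤ 1) (e : G.Arc A) (i : Fin (G.ar e.lab))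
    (j : Fin (G.ar A)) (f : G.Vertex A → ℝ≥0∞) :
    (hitInput j) (vB e i) +
        killedStep ((G.rewr ⊤ A).weight μ) (safe c₁ c₂ A) (reward ((G.rewr ⊤ A).weight μ) ⊤
        (safe c₁ c₂ A \ G.ports 2 A)
          (stopAt (G.ports 2 A) (hitInput j) f)) (vB e i) =
      ∑ j, ENNReal.ofReal (pLeft μ c₁ c₂ e i j) * f (Vertex.input j) +
        (∑ d : G.Arc A, ∑ h : Fin (G.ar d.lab),
          ENNReal.ofReal (pLevel μ c₁ c₂ e i d h) * f (vB d h) +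
        ∑ c : G.Arc e.lab, ∑ k : Fin (G.ar c.lab),
          ENNReal.ofReal (pRight μ c₁ c₂ e i c k) * f (vC e c k)) := by
  rw [killedStep_reward_stopAt hG hw e i (gn := 0) (fun y _ hP => ?_) (fun _ _ => rfl),
    reward_zero_right, hitInput_of_lev j (one_le_lev_vB hG e i), zero_add]
  · simp [killedStep]
  · refine hitInput_of_ne ?_
    rintro rfl
    refine hP ?_
    rw [← Occ.place_root_inp]
    exact place_inp_mem_ports _ (by simp [Occ.depth]) j

/-- The rewards earned at the start and at non-ports before stopping add up to `pWin`; visits to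
`V₂` at ports are accounted for by `f`. -/
theorem win_expansion (hG : G.IsOutside) {A : N}
    (hw : ∀ s, ∑' t, (G.rewr 2 A).weight μ s t ≤ 1) (e : G.Arc A) (i : Fin (G.ar e.lab))
    (f : G.Vertex A → ℝ≥0∞) :
    (goal c₂ A).indicator 1 (vB e i) +
        killedStep ((G.rewr ⊤ A).weight μ) (safe c₁ c₂ A) (reward ((G.rewr ⊤ A).weight μ) ⊤
        (safe c₁ c₂ A \ G.ports 2 A)
          (stopAt (G.ports 2 A) ((goal c₂ A).indicator 1) f)) (vB e i) =
      ENNReal.ofReal (pWin μ c₁ c₂ e i) +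
      (∑ j, ENNReal.ofReal (pLeft μ c₁ c₂ e i j) * f (Vertex.input j) +
        (∑ d : G.Arc A, ∑ h : Fin (G.ar d.lab),
          ENNReal.ofReal (pLevel μ c₁ c₂ e i d h) * f (vB d h) +
        ∑ c : G.Arc e.lab, ∑ k : Fin (G.ar c.lab),
          ENNReal.ofReal (pRight μ c₁ c₂ e i c k) * f (vC e c k))) := by
  have hgoal : ∀ {y : G.Vertex A}, Complete 2 y → (y ∈ goal c₂ A ↔ y ∈ G.locCol A c₂) := by
    intro y hy
    rw [goal, Set.mem_inter_iff, mem_colour_iff_of_complete hG hy]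
    exact and_iff_left hy.1
  rw [killedStep_reward_stopAt hG hw e i (gn := (G.locCol A c₂ \ G.ports 2 A).indicator 1)
    (fun y hy hP => ?_) (fun y hy => Set.indicator_of_notMem (fun h => h.2 hy) _), ← add_assoc,
    pWin, ofReal_probUntilAvoiding hw]
  · congr 2
    exact Set.indicator_eq_indicator (hgoal (complete_two_vB hG e i)) rfl
  · refine Set.indicator_eq_indicator ?_ rfl
    have h := hG.of_mem_region (fun p hp => depth_of_mem_near hp) hy hP
    rw [hgoal ⟨h.1, fun B Y u hu => by exact_mod_cast depth_of_mem_near (h.2 B Y u hu)⟩]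
    simp [hP]

theorem dec_top_eq (hG : G.IsOutside) {A : N}
    (hw : ∀ s, ∑' t, (G.rewr 2 A).weight μ s t ≤ 1) (e : G.Arc A) (i : Fin (G.ar e.lab))
    (j : Fin (G.ar A)) :
    dec μ c₁ c₂ ⊤ (vB e i) j = decRhs μ c₁ c₂ e i j (fun d h => dec μ c₁ c₂ ⊤ (vB d h) j)
      (fun c k l => dec μ c₁ c₂ ⊤ (vB c k) l) := by
  rw [dec, rew_top_eq (G.ports 2 A), dec_expansion hG hw, decRhs]
  congr 1
  · rw [Finset.sum_eq_single j]
    · rw [rew_top_input, hitInput_self, mul_one]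
    · intro j' _ h
      rw [rew_top_input, hitInput_of_ne fun h' => h (Vertex.input_injective h'), mul_zero]
    · simp
  · congr 1
    refine Finset.sum_congr rfl fun c _ => Finset.sum_congr rfl fun k _ => ?_
    rw [rew_top_vC hG e (gB := 0) (fun y _ => hitInput_emb hG e j y) fun _ => rfl, rew,
      reward_zero_right, Pi.zero_apply, zero_add]
    rfl

/-- The step leaving `(B,i)_A` costs one unit of time, so the values after stopping have horizon
`n`. This drives the induction for minimality. -/
theorem dec_succ_le (hG : G.IsOutside) {A : N}
    (hw : ∀ s, ∑' t, (G.rewr 2 A).weight μ s t ≤ 1) (n : ℕ) (e : G.Arc A)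
    (i : Fin (G.ar e.lab)) (j : Fin (G.ar A)) :
    dec μ c₁ c₂ (n + 1) (vB e i) j ≤ decRhs μ c₁ c₂ e i j
      (fun d h => dec μ c₁ c₂ n (vB d h) j) (fun c k l => dec μ c₁ c₂ n (vB c k) l) := by
  refine (rew_succ_le n (G.ports 2 A) _ _).trans ?_
  rw [dec_expansion hG hw, decRhs]
  refine add_le_add ?_ (add_le_add le_rfl ?_)
  · rw [Finset.sum_eq_single j]
    · refine (mul_le_mul_right (rew_input_le _ _ j) _).trans ?_
      rw [hitInput_self, mul_one]
    · intro j' _ h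
      refine le_antisymm ((mul_le_mul_right (rew_input_le _ _ j') _).trans ?_) zero_le
      rw [hitInput_of_ne fun h' => h (Vertex.input_injective h'), mul_zero]
    · simp
  · refine Finset.sum_le_sum fun c _ => Finset.sum_le_sum fun k _ => mul_le_mul_right ?_ _
    refine (rew_vC_le hG e (gB := 0) (fun y _ => hitInput_emb hG e j y)
      (fun _ => rfl) n c k).trans (le_of_eq ?_)
    rw [rew, reward_zero_right, Pi.zero_apply, zero_add]
    rfl

theorem win_top_eq (hG : G.IsOutside) {A : N}
    (hw : ∀ s, ∑' t, (G.rewr 2 A).weight μ s t ≤ 1) (e : G.Arc A) (i : Fin (G.ar e.lab)) :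
    win μ c₁ c₂ ⊤ (vB e i) = winRhs μ c₁ c₂ e i (fun d h => win μ c₁ c₂ ⊤ (vB d h))
      (fun c k => win μ c₁ c₂ ⊤ (vB c k)) (fun c k l => dec μ c₁ c₂ ⊤ (vB c k) l) := by
  rw [win, rew_top_eq (G.ports 2 A), win_expansion hG hw, winRhs]
  congr 1
  -- Inputs contribute nothing: `goal` excludes them and the walk is killed there.
  rw [Finset.sum_eq_zero, zero_add]
  · congr 1
    refine Finset.sum_congr rfl fun c _ => Finset.sum_congr rfl fun k _ => ?_
    rw [rew_top_vC hG e (indicator_goal_emb hG _) indicator_goal_input]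
    rfl
  · intro j _
    rw [rew_top_input, indicator_goal_input, mul_zero]

theorem win_succ_le (hG : G.IsOutside) {A : N}
    (hw : ∀ s, ∑' t, (G.rewr 2 A).weight μ s t ≤ 1) (n : ℕ) (e : G.Arc A)
    (i : Fin (G.ar e.lab)) :
    win μ c₁ c₂ (n + 1) (vB e i) ≤ winRhs μ c₁ c₂ e i (fun d h => win μ c₁ c₂ n (vB d h))
      (fun c k => win μ c₁ c₂ n (vB c k)) (fun c k l => dec μ c₁ c₂ n (vB c k) l) := by
  refine (rew_succ_le n (G.ports 2 A) _ _).trans ?_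
  rw [win_expansion hG hw, winRhs, Finset.sum_eq_zero, zero_add]
  · refine add_le_add le_rfl (add_le_add le_rfl ?_)
    refine Finset.sum_le_sum fun c _ => Finset.sum_le_sum fun k _ => mul_le_mul_right ?_ _
    exact rew_vC_le hG e (indicator_goal_emb hG _) indicator_goal_input n c k
  · intro j _
    refine le_antisymm ((mul_le_mul_right (rew_input_le _ _ j) _).trans ?_) zero_le
    rw [indicator_goal_input, mul_zero]

end equations

end HRGrammar

namespace HRGrammar

variable {N T₁ T₂ : Type*} {G : HRGrammar N T₁ T₂}

section solution
variable [Fintype T₂] {μ : T₂ → Set.Icc (0 : ℝ) 1} {c₁ c₂ : T₁}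

/-! ### Boundary values -/

theorem dec_eq_zero (hG : G.IsOutside) {A : N} (e : G.Arc A) (i : Fin (G.ar e.lab))
    (h : vB e i ∉ G.locCol A c₁ \ G.locCol A c₂) (j : Fin (G.ar A)) :
    dec μ c₁ c₂ ⊤ (vB e i) j = 0 := by
  have hs : vB e i ∉ safe c₁ c₂ A :=
    fun hs => h ((mem_safe_iff_of_complete hG (complete_two_vB hG e i)).1 hs)
  refine le_antisymm ((reward_le_of_notMem _ _ hs).trans ?_) zero_le
  rw [hitInput_of_lev j (one_le_lev_vB hG e i)]

theorem win_eq_indicator (hG : G.IsOutside) {A : N} (e : G.Arc A) (i : Fin (G.ar e.lab))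
    (h : vB e i ∉ G.locCol A c₁ \ G.locCol A c₂) :
    win μ c₁ c₂ ⊤ (vB e i) = (G.locCol A c₂).indicator 1 (vB e i) := by
  have hs : vB e i ∉ safe c₁ c₂ A :=
    fun hs => h ((mem_safe_iff_of_complete hG (complete_two_vB hG e i)).1 hs)
  have h1 : win μ c₁ c₂ ⊤ (vB e i) = (goal c₂ A).indicator 1 (vB e i) := by
    have := reward_of_notMem (w := (G.rewr ⊤ A).weight μ) ⊤ ((goal c₂ A).indicator 1) hs
    rwa [top_add] at this
  rw [h1]
  refine Set.indicator_eq_indicator ?_ rfl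
  rw [goal, Set.mem_inter_iff, mem_colour_iff_of_complete hG (complete_two_vB hG e i)]
  exact and_iff_left (one_le_lev_vB hG e i)

theorem ofReal_probU (hμ : G.IsProbabilistic μ) (v : G.Vertex G.start) :
    ENNReal.ofReal (G.probU μ c₁ c₂ v) = win μ c₁ c₂ ⊤ v := by
  have hlev : ∀ y : G.Vertex G.start, 1 ≤ y.lev := by
    intro y
    rcases y.exists_place with ⟨j, rfl⟩ | ⟨C, Y, v, hv, rfl⟩
    · exact absurd j.2 (by simp [G.start_arity])
    · rw [Occ.lev_place _ hv]; lia
  have hsafe : (G.rewr ⊤ G.start).colour c₁ \ (G.rewr ⊤ G.start).colour c₂ =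
      safe c₁ c₂ G.start := by
    ext y; simp [safe, hlev]
  have hgoal : (G.rewr ⊤ G.start).colour c₂ = goal c₂ G.start := by
    ext y; simp [goal, hlev]
  rw [probU, ofReal_probUntil hμ.tsum_weight_le_one, hsafe, hgoal]
  rfl

/-! ### Real-valued equations -/

theorem pHit_nonneg {A : N} (e : G.Arc A) (i : Fin (G.ar e.lab)) (x : G.Vertex A) :
    0 ≤ pHit μ c₁ c₂ e i x := MeasureTheory.measureReal_nonneg

theorem pWin_nonneg {A : N} (e : G.Arc A) (i : Fin (G.ar e.lab)) :
    0 ≤ pWin μ c₁ c₂ e i := MeasureTheory.measureReal_nonneg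

theorem ofReal_sum_mul {ι : Type*} {κ : ι → Type*} [Fintype ι] [∀ a, Fintype (κ a)]
    {p q : ∀ a, κ a → ℝ} (hp : ∀ a b, 0 ≤ p a b) (hq : ∀ a b, 0 ≤ q a b) :
    ENNReal.ofReal (∑ a, ∑ b, p a b * q a b) =
      ∑ a, ∑ b, ENNReal.ofReal (p a b) * ENNReal.ofReal (q a b) := by
  rw [ENNReal.ofReal_sum_of_nonneg fun a _ => Finset.sum_nonneg fun b _ =>
    mul_nonneg (hp a b) (hq a b)]
  refine Finset.sum_congr rfl fun a _ => ?_
  rw [ENNReal.ofReal_sum_of_nonneg fun b _ => mul_nonneg (hp a b) (hq a b)]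
  exact Finset.sum_congr rfl fun b _ => ENNReal.ofReal_mul (hp a b)

theorem ofReal_sum_mul' {ι : Type*} [Fintype ι] {p q : ι → ℝ} (hp : ∀ a, 0 ≤ p a)
    (hq : ∀ a, 0 ≤ q a) :
    ENNReal.ofReal (∑ a, p a * q a) = ∑ a, ENNReal.ofReal (p a) * ENNReal.ofReal (q a) := by
  rw [ENNReal.ofReal_sum_of_nonneg fun a _ => mul_nonneg (hp a) (hq a)]
  exact Finset.sum_congr rfl fun a _ => ENNReal.ofReal_mul (hp a)

theorem double_sum_nonneg {ι : Type*} {κ : ι → Type*} [Fintype ι] [∀ a, Fintype (κ a)]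
    {p q : ∀ a, κ a → ℝ} (hp : ∀ a b, 0 ≤ p a b) (hq : ∀ a b, 0 ≤ q a b) :
    0 ≤ ∑ a, ∑ b, p a b * q a b :=
  Finset.sum_nonneg fun a _ => Finset.sum_nonneg fun b _ => mul_nonneg (hp a b) (hq a b)

variable [Finite N]

/-- For nonnegative data `ENNReal.ofReal` is injective and commutes with sums and products, so the
real equations can be studied in `[0,∞]`. -/
theorem eq_decRhs_iff {A : N} (e : G.Arc A) (i : Fin (G.ar e.lab)) (j : Fin (G.ar A))
    {x : ∀ d : G.Arc A, Fin (G.ar d.lab) → ℝ}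
    {x' : ∀ c : G.Arc e.lab, Fin (G.ar c.lab) → Fin (G.ar e.lab) → ℝ}
    (hx : ∀ d h, 0 ≤ x d h) (hx' : ∀ c k l, 0 ≤ x' c k l) {r : ℝ} (hr : 0 ≤ r) :
    r = pLeft μ c₁ c₂ e i j
      + ∑ d : G.Arc A, ∑ h : Fin (G.ar d.lab), pLevel μ c₁ c₂ e i d h * x d h
      + ∑ c : G.Arc e.lab, ∑ k : Fin (G.ar c.lab), pRight μ c₁ c₂ e i c k *
          ∑ l : Fin (G.ar e.lab), x' c k l * x e l ↔
    ENNReal.ofReal r = decRhs μ c₁ c₂ e i j (fun d h => ENNReal.ofReal (x d h))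
      (fun c k l => ENNReal.ofReal (x' c k l)) := by
  have h1 : 0 ≤ pLeft μ c₁ c₂ e i j := pHit_nonneg _ _ _
  have h2 : ∀ (d : G.Arc A) (h : Fin (G.ar d.lab)), 0 ≤ pLevel μ c₁ c₂ e i d h :=
    fun _ _ => pHit_nonneg _ _ _
  have h3 : ∀ (c : G.Arc e.lab) (k : Fin (G.ar c.lab)), 0 ≤ pRight μ c₁ c₂ e i c k :=
    fun _ _ => pHit_nonneg _ _ _
  have h4 : ∀ (c : G.Arc e.lab) (k : Fin (G.ar c.lab)),
      0 ≤ ∑ l : Fin (G.ar e.lab), x' c k l * x e l :=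
    fun c k => Finset.sum_nonneg fun l _ => mul_nonneg (hx' _ _ _) (hx _ _)
  have h5 := double_sum_nonneg h2 hx
  have h6 := double_sum_nonneg h3 h4
  rw [← ENNReal.ofReal_eq_ofReal_iff hr (add_nonneg (add_nonneg h1 h5) h6),
    ENNReal.ofReal_add (add_nonneg h1 h5) h6, ENNReal.ofReal_add h1 h5,
    ofReal_sum_mul h2 hx, ofReal_sum_mul h3 h4, add_assoc, decRhs]
  simp only [ofReal_sum_mul' (hx' _ _) (hx e)]

theorem eq_winRhs_iff {A : N} (e : G.Arc A) (i : Fin (G.ar e.lab))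
    {y : ∀ d : G.Arc A, Fin (G.ar d.lab) → ℝ}
    {y' : ∀ c : G.Arc e.lab, Fin (G.ar c.lab) → ℝ}
    {x' : ∀ c : G.Arc e.lab, Fin (G.ar c.lab) → Fin (G.ar e.lab) → ℝ}
    (hy : ∀ d h, 0 ≤ y d h) (hy' : ∀ c k, 0 ≤ y' c k) (hx' : ∀ c k l, 0 ≤ x' c k l) {r : ℝ}
    (hr : 0 ≤ r) :
    r = pWin μ c₁ c₂ e i
      + ∑ d : G.Arc A, ∑ h : Fin (G.ar d.lab), pLevel μ c₁ c₂ e i d h * y d h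
      + ∑ c : G.Arc e.lab, ∑ k : Fin (G.ar c.lab), pRight μ c₁ c₂ e i c k *
          (y' c k + ∑ l : Fin (G.ar e.lab), x' c k l * y e l) ↔
    ENNReal.ofReal r = winRhs μ c₁ c₂ e i (fun d h => ENNReal.ofReal (y d h))
      (fun c k => ENNReal.ofReal (y' c k)) (fun c k l => ENNReal.ofReal (x' c k l)) := by
  have h1 : 0 ≤ pWin μ c₁ c₂ e i := pWin_nonneg _ _
  have h2 : ∀ (d : G.Arc A) (h : Fin (G.ar d.lab)), 0 ≤ pLevel μ c₁ c₂ e i d h :=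
    fun _ _ => pHit_nonneg _ _ _
  have h3 : ∀ (c : G.Arc e.lab) (k : Fin (G.ar c.lab)), 0 ≤ pRight μ c₁ c₂ e i c k :=
    fun _ _ => pHit_nonneg _ _ _
  have h4' : ∀ (c : G.Arc e.lab) (k : Fin (G.ar c.lab)),
      0 ≤ ∑ l : Fin (G.ar e.lab), x' c k l * y e l :=
    fun c k => Finset.sum_nonneg fun l _ => mul_nonneg (hx' _ _ _) (hy _ _)
  have h4 : ∀ (c : G.Arc e.lab) (k : Fin (G.ar c.lab)),
      0 ≤ y' c k + ∑ l : Fin (G.ar e.lab), x' c k l * y e l :=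
    fun c k => add_nonneg (hy' _ _) (h4' c k)
  have h5 := double_sum_nonneg h2 hy
  have h6 := double_sum_nonneg h3 h4
  rw [← ENNReal.ofReal_eq_ofReal_iff hr (add_nonneg (add_nonneg h1 h5) h6),
    ENNReal.ofReal_add (add_nonneg h1 h5) h6, ENNReal.ofReal_add h1 h5,
    ofReal_sum_mul h2 hy, ofReal_sum_mul h3 h4, add_assoc, winRhs]
  simp only [ENNReal.ofReal_add (hy' _ _) (h4' _ _), ofReal_sum_mul' (hx' _ _) (hy e)]

theorem decEquations_iff {x : G.DecVal} (hx : ∀ A e i j, 0 ≤ x A e i j) :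
    DecEquations μ c₁ c₂ x ↔ ∀ (A : G.Reach) (e : G.Arc A.1) (i : Fin (G.ar e.lab))
      (j : Fin (G.ar A.1)), ENNReal.ofReal (x A e i j) = decRhs μ c₁ c₂ e i j
        (fun d h => ENNReal.ofReal (x A d h j))
        (fun c k l => ENNReal.ofReal (x (A.succ e) c k l)) :=
  forall_congr' fun A => forall_congr' fun e => forall_congr' fun i => forall_congr' fun j =>
    eq_decRhs_iff e i j (fun d h => hx A d h j) (fun c k l => hx (A.succ e) c k l) (hx A e i j)

theorem winEquations_iff {x : G.DecVal} {y : G.WinVal} (hx : ∀ A e i j, 0 ≤ x A e i j)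
    (hy : ∀ A e i, 0 ≤ y A e i) :
    WinEquations μ c₁ c₂ x y ↔ ∀ (A : G.Reach) (e : G.Arc A.1) (i : Fin (G.ar e.lab)),
      ENNReal.ofReal (y A e i) = winRhs μ c₁ c₂ e i
        (fun d h => ENNReal.ofReal (y A d h))
        (fun c k => ENNReal.ofReal (y (A.succ e) c k))
        (fun c k l => ENNReal.ofReal (x (A.succ e) c k l)) :=
  forall_congr' fun A => forall_congr' fun e => forall_congr' fun i =>
    eq_winRhs_iff e i (fun d h => hy A d h) (fun c k => hy (A.succ e) c k)
      (fun c k l => hx (A.succ e) c k l) (hy A e i)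

/-! ### Minimality -/

theorem dec_le_of_equations (hG : G.IsOutside)
    (hw : ∀ (A : G.Reach) s, ∑' t, (G.rewr 2 A.1).weight μ s t ≤ 1) {x : G.DecVal}
    (hx : ∀ A e i j, 0 ≤ x A e i j) (h : DecEquations μ c₁ c₂ x) (n : ℕ) (A : G.Reach)
    (e : G.Arc A.1) (i : Fin (G.ar e.lab)) (j : Fin (G.ar A.1)) :
    dec μ c₁ c₂ n (vB e i) j ≤ ENNReal.ofReal (x A e i j) := by
  rw [decEquations_iff hx] at h
  -- The induction runs over all reachable non-terminals at once, as the equation at `A` refers to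
  -- values at `A.succ e`.
  induction n generalizing A with
  | zero => rw [Nat.cast_zero, dec, rew, reward_zero]; exact zero_le
  | succ n ih =>
    rw [h, Nat.cast_add_one]
    exact (dec_succ_le hG (hw A) n e i j).trans (decRhs_mono e i j (fun d k => ih A d k j)
      fun c k l => ih (A.succ e) c k l)

theorem win_le_of_equations (hG : G.IsOutside)
    (hw : ∀ (A : G.Reach) s, ∑' t, (G.rewr 2 A.1).weight μ s t ≤ 1) {x : G.DecVal}
    {y : G.WinVal} (hx : ∀ A e i j, 0 ≤ x A e i j) (hy : ∀ A e i, 0 ≤ y A e i)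
    (h : DecEquations μ c₁ c₂ x) (h' : WinEquations μ c₁ c₂ x y) (n : ℕ) (A : G.Reach)
    (e : G.Arc A.1) (i : Fin (G.ar e.lab)) :
    win μ c₁ c₂ n (vB e i) ≤ ENNReal.ofReal (y A e i) := by
  rw [winEquations_iff hx hy] at h'
  induction n generalizing A with
  | zero => rw [Nat.cast_zero, win, rew, reward_zero]; exact zero_le
  | succ n ih =>
    rw [h', Nat.cast_add_one]
    exact (win_succ_le hG (hw A) n e i).trans (winRhs_mono e i (fun d k => ih A d k)
      (fun c k => ih (A.succ e) c k)
      fun c k l => dec_le_of_equations hG hw hx h n (A.succ e) c k l)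

/-! ### The probability from a vertex of the axiom -/

theorem win_start_eq (hG : G.IsOutside) (hμ : G.IsProbabilistic μ) (v₀ : G.V G.start) :
    win μ c₁ c₂ ⊤ ((Occ.root : G.Occ G.start G.start).place v₀) =
      ENNReal.ofReal (G.pStart μ c₁ c₂ v₀) +
        ∑ e : G.Arc G.start, ∑ i : Fin (G.ar e.lab),
          ENNReal.ofReal (G.pStartRight μ c₁ c₂ v₀ e i) * win μ c₁ c₂ ⊤ (vB e i) := by
  set O : Set (Σ B, G.Occ G.start B) := {⟨G.start, .root⟩}
  have hO : ∀ p ∈ O, p.2.depth + 1 ≤ 1 := by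
    rintro p rfl; simp [Occ.depth]
  have hw := hμ.tsum_weight_rewr_le_one hG .root 1
  set q : (Σ e : G.Arc G.start, Fin (G.ar e.lab)) → G.Vertex G.start := fun p => vB p.1 p.2
  have hq : Function.Injective q := fun p p' h => hG.att_inj (hG.place_injective _ h)
  have hqP : ∀ p, q p ∈ G.ports 1 G.start := fun p =>
    place_att_mem_ports .root (by simp [Occ.depth]) p.1 p.2
  have hqO : ∀ y ∈ region O, y ∈ G.ports 1 G.start → y ∈ Set.range q := by
    intro y hy hP
    obtain ⟨p, rfl, h⟩ := hG.of_mem_region_of_mem_ports hy hP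
    rcases h with ⟨j, rfl⟩ | ⟨e, i, rfl⟩
    · exact absurd j.2 (by simp [G.start_arity])
    · exact ⟨⟨e, i⟩, rfl⟩
  have hg : ∀ y ∈ region O, y ∉ G.ports 1 G.start →
      (goal c₂ G.start).indicator (1 : G.Vertex G.start → ℝ≥0∞) y =
        ((G.rewr 1 G.start).colour c₂ \ G.ports 1 G.start).indicator 1 y := by
    intro y hy hP
    refine Set.indicator_eq_indicator ?_ rfl
    have h := hG.of_mem_region hO hy hP
    have hc : Complete 1 y := ⟨h.1, fun B Y u hu => by exact_mod_cast hO _ (h.2 B Y u hu)⟩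
    rw [goal, Set.mem_inter_iff, mem_colour_iff_of_complete hG hc, Set.mem_sdiff,
      and_iff_left (show y ∈ {y : G.Vertex G.start | 1 ≤ y.lev} from h.1), and_iff_left hP]
  -- Ports are already excluded from the left factor, so deleting all of `V₂` or only its non-ports
  -- amounts to the same.
  have hsub : ((G.rewr 1 G.start).colour c₁ \ G.ports 1 G.start) \
      ((G.rewr 1 G.start).colour c₂ \ G.ports 1 G.start) =
      ((G.rewr 1 G.start).colour c₁ \ (G.rewr 1 G.start).colour c₂) \ G.ports 1 G.start := by
    ext y
    simp only [Set.mem_sdiff]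
    tauto
  have hwin : ∀ y, win μ c₁ c₂ ⊤ y = reward ((G.rewr ⊤ G.start).weight μ) ⊤
      (safe c₁ c₂ G.start \ G.ports 1 G.start)
      (stopAt (G.ports 1 G.start) ((goal c₂ G.start).indicator 1) (win μ c₁ c₂ ⊤)) y :=
    -- No preliminary step here: stopping is allowed at time `0`, for `v₀` may lie on a hyperarc.
    fun y => (congrFun (reward_stopped _ _ _) y).symm
  rw [hwin, reward_stopAt_ports (n := 1) hG hO hq hqP hqO hg
    (fun y hy => Set.indicator_of_notMem (fun h => h.2 hy) _) _ _
    ⟨⟨G.start, .root⟩, rfl, v₀, rfl⟩, pStart, ofReal_probUntil hw, hsub, tsum_fintype,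
    Fintype.sum_sigma]
  congr 1
  refine Finset.sum_congr rfl fun e _ => Finset.sum_congr rfl fun i _ => ?_
  rw [pStartRight, ofReal_probUntil hw, mul_comm,
    Set.sdiff_singleton_eq_self fun h => h.2 (hqP ⟨e, i⟩)]
  rfl

theorem probU_eq (hG : G.IsOutside) (hμ : G.IsProbabilistic μ) (v₀ : G.V G.start)
    {y : ∀ e : G.Arc G.start, Fin (G.ar e.lab) → ℝ} (hy : ∀ e i, 0 ≤ y e i)
    (h : ∀ e i, ENNReal.ofReal (y e i) = win μ c₁ c₂ ⊤ (vB e i)) :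
    G.probU μ c₁ c₂ ((Occ.root : G.Occ G.start G.start).place v₀) = G.pStart μ c₁ c₂ v₀ +
      ∑ e : G.Arc G.start, ∑ i : Fin (G.ar e.lab), G.pStartRight μ c₁ c₂ v₀ e i * y e i := by
  have h1 : ∀ (e : G.Arc G.start) (i : Fin (G.ar e.lab)),
      0 ≤ G.pStartRight μ c₁ c₂ v₀ e i := fun _ _ => MeasureTheory.measureReal_nonneg
  have h0 : 0 ≤ G.pStart μ c₁ c₂ v₀ := MeasureTheory.measureReal_nonneg
  have hU : 0 ≤ G.probU μ c₁ c₂ ((Occ.root : G.Occ G.start G.start).place v₀) :=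
    MeasureTheory.measureReal_nonneg
  have h2 := double_sum_nonneg h1 hy
  rw [← ENNReal.ofReal_eq_ofReal_iff hU (add_nonneg h0 h2), ofReal_probU hμ,
    win_start_eq hG hμ, ENNReal.ofReal_add h0 h2, ofReal_sum_mul h1 hy]
  simp only [h]

end solution

end HRGrammar

/-! ### Assembly of the theorem. -/

theorem mainTheorem3 {N T₁ T₂ : Type*} [Finite N] [Finite T₁] [Fintype T₂]
    (G : HRGrammar N T₁ T₂) (hG : G.IsOutside)
    (μ : T₂ → Set.Icc (0 : ℝ) 1) (hμ : G.IsProbabilistic μ) (c₁ c₂ : T₁) :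
    ∃ (Dec : G.DecVal) (Win : G.WinVal),
      (∀ (A : G.Reach) (X : G.Occ G.start A.1) (e : G.Arc A.1) (i : Fin (G.ar e.lab)),
        (∀ j, HRGrammar.decAt μ c₁ c₂ X e i j = Dec A e i j) ∧
          HRGrammar.winAt μ c₁ c₂ X e i = Win A e i) ∧
      HRGrammar.DecEquations μ c₁ c₂ Dec ∧
      HRGrammar.WinEquations μ c₁ c₂ Dec Win ∧
      IsLeast {z : G.DecVal × G.WinVal | 0 ≤ z ∧
          HRGrammar.DecEquations μ c₁ c₂ z.1 ∧
          HRGrammar.WinEquations μ c₁ c₂ z.1 z.2 ∧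
          HRGrammar.BoundaryConstraints c₁ c₂ z.1 z.2} (Dec, Win) ∧
      ∀ v₀ : G.V G.start,
        G.probU μ c₁ c₂ ((HRGrammar.Occ.root : G.Occ G.start G.start).place v₀) =
          G.pStart μ c₁ c₂ v₀ +
            ∑ e : G.Arc G.start, ∑ i : Fin (G.ar e.lab),
              G.pStartRight μ c₁ c₂ v₀ e i *
                Win ⟨G.start, ⟨HRGrammar.Occ.root⟩⟩ e i := by
  open HRGrammar in
  have hw : ∀ (A : G.Reach) s, ∑' t, (G.rewr 2 A.1).weight μ s t ≤ 1 := fun A s =>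
    hμ.tsum_weight_rewr_le_one hG A.2.some 2 s
  set Dec : G.DecVal := fun A e i j => (dec μ c₁ c₂ ⊤ (vB e i) j).toReal
  set Win : G.WinVal := fun A e i => (win μ c₁ c₂ ⊤ (vB e i)).toReal
  have hd : ∀ (A : G.Reach) (e : G.Arc A.1) i j,
      ENNReal.ofReal (Dec A e i j) = dec μ c₁ c₂ ⊤ (vB e i) j := fun A e i j => by
    refine ENNReal.ofReal_toReal ?_
    -- Finiteness: reachability provides an occurrence, at which this value is a genuine
    -- probability.
    rw [← ofReal_decAt hG hμ A.2.some]
    exact ENNReal.ofReal_ne_top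
  have hv : ∀ (A : G.Reach) (e : G.Arc A.1) i,
      ENNReal.ofReal (Win A e i) = win μ c₁ c₂ ⊤ (vB e i) := fun A e i => by
    refine ENNReal.ofReal_toReal ?_
    rw [← ofReal_winAt hG hμ A.2.some]
    exact ENNReal.ofReal_ne_top
  have hd0 : ∀ A e i j, 0 ≤ Dec A e i j := fun _ _ _ _ => ENNReal.toReal_nonneg
  have hv0 : ∀ A e i, 0 ≤ Win A e i := fun _ _ _ => ENNReal.toReal_nonneg
  have hDecEq : DecEquations μ c₁ c₂ Dec := (decEquations_iff hd0).2 fun A e i j =>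
    (hd A e i j).trans ((dec_top_eq hG (hw A) e i j).trans (congrArg₂ (decRhs μ c₁ c₂ e i j)
      (funext fun d => funext fun h => (hd A d h j).symm)
      (funext fun c => funext fun k => funext fun l => (hd (A.succ e) c k l).symm)))
  have hWinEq : WinEquations μ c₁ c₂ Dec Win := (winEquations_iff hd0 hv0).2 fun A e i =>
    (hv A e i).trans ((win_top_eq hG (hw A) e i).trans (congr (congrArg₂ (winRhs μ c₁ c₂ e i)
      (funext fun d => funext fun h => (hv A d h).symm)
      (funext fun c => funext fun k => (hv (A.succ e) c k).symm))
      (funext fun c => funext fun k => funext fun l => (hd (A.succ e) c k l).symm)))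
  refine ⟨Dec, Win, fun A X e i => ⟨fun j => ?_, ?_⟩, hDecEq, hWinEq,
    ⟨⟨⟨hd0, hv0⟩, hDecEq, hWinEq, fun A e i => ⟨fun h j => ?_, fun h => ?_, fun h => ?_⟩⟩,
    ?_⟩, fun v₀ => probU_eq hG hμ v₀ (hv0 ⟨G.start, ⟨Occ.root⟩⟩) (hv ⟨G.start, ⟨Occ.root⟩⟩)⟩
  · exact (ENNReal.toReal_ofReal MeasureTheory.measureReal_nonneg).symm.trans
      (congrArg ENNReal.toReal (ofReal_decAt hG hμ X e i j))
  · exact (ENNReal.toReal_ofReal MeasureTheory.measureReal_nonneg).symm.trans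
      (congrArg ENNReal.toReal (ofReal_winAt hG hμ X e i))
  · exact congrArg ENNReal.toReal (dec_eq_zero hG e i h j)
  · refine (congrArg ENNReal.toReal (win_eq_indicator hG e i fun h' => h'.2 h)).trans ?_
    rw [Set.indicator_of_mem h, Pi.one_apply, ENNReal.toReal_one]
  · refine (congrArg ENNReal.toReal
      (win_eq_indicator hG e i fun h' => h (Or.inl h'.1))).trans ?_
    rw [Set.indicator_of_notMem fun h' => h (Or.inr h'), ENNReal.toReal_zero]
  · rintro ⟨x, y⟩ ⟨⟨hx, hy⟩, h1, h2, -⟩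
    refine ⟨fun A e i j => ?_, fun A e i => ?_⟩
    · rw [← ENNReal.ofReal_le_ofReal_iff (hx A e i j), hd, dec, rew, reward_top_eq_iSup]
      exact iSup_le fun n => dec_le_of_equations hG hw hx h1 n A e i j
    · rw [← ENNReal.ofReal_le_ofReal_iff (hy A e i), hv, win, rew, reward_top_eq_iSup]
      exact iSup_le fun n => win_le_of_equations hG hw hx hy h1 h2 n A e i
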